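/- Let $(E,\oplus,0)$ be a partial commutative monoid: a set $E$ with an element $0$ and a partial binary operation $\oplus$ such that $a\oplus b\simeq b\oplus a$, $a\oplus 0=a=0\oplus a$ and $(a\oplus b)\oplus c\simeq a\oplus(b\oplus c)$, where $\simeq$ means that if one side is defined then so is the other and they are equal. Write $a\leqslant b$ if $a\oplus c=b$ for some $c$, and let $\mathbf E$ be the preorder $(E,\leqslant)$ with the $\mathsf{Bool}$-promonoidal structure $P(a,b;c)=\top$ iff $a\oplus b$ is defined and $a\oplus b\leqslant c$, and $I(c)=\top$ for all $c$. Let $(\mathbb C_{\mathrm{obj}},\otimes,I)$ be a monoid, seen as a discrete monoidal category. An *$E$-graded monoidal category with monoid of objects $\mathbb C_{\mathrm{obj}}$* consists of a category $\mathbb C_a$ with set of objects $\mathbb C_{\mathrm{obj}}$ for each $a\in E$ (its composition is written in diagrammatic order), identity-on-objects functors $(-)_a^b:\mathbb C_a\to\mathbb C_b$ for $a\leqslant b$, and functions $\otimes_{a,b}:\mathbb C_a(X;Y)\times\mathbb C_b(X';Y')\to\mathbb C_{a\oplus b}(X\otimes X';Y\otimes Y')$ whenever $a\oplus b$ is defined,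 such that, whenever well typed: $f_a^a=f$ and $(f_a^b)_b^c=f_a^c$; $(f\otimes g)_{a\oplus b}^{c\oplus d}=f_a^c\otimes g_b^d$; $f\otimes\mathrm{id}_I=f=\mathrm{id}_I\otimes f$ and $(f\otimes g)\otimes h=f\otimes(g\otimes h)$; $\mathrm{id}_X\otimes\mathrm{id}_Y=\mathrm{id}_{X\otimes Y}$; and $(f\otimes g)⨾(h\otimes k)=(f⨾h)\otimes(g⨾k)$. Here $\mathrm{id}$ without a grade denotes the identities of $\mathbb C_0$. Equip $[\mathbf E,\mathrm{Set}]$ with the convolution monoidal structure $(\ast,J)$, where $(F\ast G)(c)$ is the quotient of $\coprod_{a\oplus b\leqslant c}F(a)\times G(b)$ by the equivalence relation generated by $(a,b,x,y)\sim(a',b',F(a\leqslant a')(x),G(b\leqslant b')(y))$ for $a\leqslant a'$, $b\leqslant b'$, $a'\oplus b'\leqslant c$, and $J(c)=\{*\}$. Together with the pointwise cartesian structure $(\times,K)$ this is a duoidal category. The category $\mathbf{MonCat}_{\mathrm{lax}}(\mathbb C_{\mathrm{obj}}^{\mathrm{op}}\times\mathbb C_{\mathrm{obj}},([\mathbf E,\mathrm{Set}],\ast,J))$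 of lax monoidal functors and monoidal natural transformations carries the monoidal structure $(\circ,L)$ with $(P\circ Q)(X;Z)=\coprod_{Y}Q(X;Y)\times P(Y;Z)$, and $L(X;Y)=K$ if $X=Y$ and $L(X;Y)=\varnothing$ otherwise. **Theorem.** $E$-graded monoidal categories with monoid of objects $\mathbb C_{\mathrm{obj}}$ are precisely monoids in $(\mathbf{MonCat}_{\mathrm{lax}}(\mathbb C_{\mathrm{obj}}^{\mathrm{op}}\times\mathbb C_{\mathrm{obj}},([\mathbf E,\mathrm{Set}],\ast,J)),\circ,L)$: there is a bijection between the two under which the graded monoidal category $\mathbb C$ corresponds to a monoid whose underlying lax monoidal functor has value $\mathbb C_a(X;Y)$ at $(X,Y)$ and $a$, with the regradings as its action on $a\leqslant b$, whose laxator restricts to $\otimes_{a,b}$ when its target grade is $a\oplus b$, and whose multiplication and unit are the compositions and the identities of the categories $\mathbb C_a$. In the same sense, they are precisely the Freyd categories over the discrete monoidal category $\mathbb C_{\mathrm{obj}}$ enriched in the duoidal category $([\mathbf E,\mathrm{Set}],\ast,J,\times,K)$, that is: lax monoidal functors $H:\mathbb C_{\mathrm{obj}}^{\mathrm{op}}\times\mathbb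 C_{\mathrm{obj}}\to([\mathbf E,\mathrm{Set}],\ast,J)$ with associative and unital maps $H(X;Y)\times H(Y;Z)\to H(X;Z)$ and $K\to H(X;X)$, such that the lax unit $J\to H(I;I)$ is the composite $J\to K\to H(I;I)$, and the laxator commutes with these identities and compositions through the canonical maps $K\ast K\to K$ and $(A\times B)\ast(C\times D)\to(A\ast C)\times(B\ast D)$. -/

import Mathlib

open CategoryTheory MonoidalCategory Opposite

universe u v w v' w'

set_option linter.unusedVariables false

namespace PCMGraded

/-! ### Partial commutative monoids and the extension preorder -/

/-- A partial commutative monoid. The partial operation takes values in `Part E`, so that equality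
of values is Kleene equality: one side is defined iff the other is, and then they agree. -/
class PartialCommMonoid (E : Type u) where
  /-- the partial operation `a ⊕ b` -/
  add : E → E → Part E
  /-- the neutral element -/
  zero : E
  add_comm' : ∀ a b, add a b = add b a
  add_zero' : ∀ a, add a zero = Part.some a
  zero_add' : ∀ a, add zero a = Part.some a
  add_assoc' : ∀ a b c, ((add a b).bind fun x => add x c) = ((add b c).bind fun y => add a y)

namespace PartialCommMonoid

variable {E : Type u} [PartialCommMonoid E]

theorem mem_comm {a b s : E} (h : s ∈ add a b) : s ∈ add b a := by
  rwa [add_comm']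

theorem mem_zero (a : E) : a ∈ add a (zero : E) := by
  rw [add_zero']; exact Part.mem_some a

theorem zero_mem (a : E) : a ∈ add (zero : E) a := by
  rw [zero_add']; exact Part.mem_some a

theorem assoc_right {a b c s t : E} (h : s ∈ add a b) (h' : t ∈ add s c) :
    ∃ r, r ∈ add b c ∧ t ∈ add a r := by
  have h1 : t ∈ ((add a b).bind fun x => add x c) := Part.mem_bind h h'
  rw [add_assoc'] at h1
  exact Part.mem_bind_iff.1 h1

theorem assoc_left {a b c r t : E} (h : r ∈ add b c) (h' : t ∈ add a r) :
    ∃ s, s ∈ add a b ∧ t ∈ add s c := by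
  have h1 : t ∈ ((add b c).bind fun y => add a y) := Part.mem_bind h h'
  rw [← add_assoc'] at h1
  exact Part.mem_bind_iff.1 h1

/-- The extension preorder: `a ≤ b` iff `a ⊕ c = b` for some `c`. -/
instance extensionPreorder : Preorder E where
  le a b := ∃ c, b ∈ add a c
  le_refl a := ⟨zero, mem_zero a⟩
  le_trans a b c := by
    rintro ⟨x, hx⟩ ⟨y, hy⟩
    obtain ⟨r, -, hr⟩ := assoc_right hx hy
    exact ⟨r, hr⟩

theorem zero_le' (a : E) : (zero : E) ≤ a := ⟨a, zero_mem a⟩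

/-- `x ≤ y` and `y ⟂ b` imply `x ⟂ b` and `x ⊕ b ≤ y ⊕ b`. -/
theorem exists_add_le {x y b s : E} (h : x ≤ y) (hs : s ∈ add y b) :
    ∃ t, t ∈ add x b ∧ t ≤ s := by
  obtain ⟨c, hc⟩ := h
  obtain ⟨r, hr, hr'⟩ := assoc_right (mem_comm hc) hs
  exact ⟨r, hr, ⟨c, mem_comm hr'⟩⟩

/-- `a ⊕ b ≤ c`, i.e. `a ⊕ b` is defined and below `c` in the extension preorder. -/
def AddLE (a b c : E) : Prop := ∃ s, s ∈ add a b ∧ s ≤ c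

theorem AddLE.mono {a a' b b' c c' : E} (h : AddLE a b c) (ha : a' ≤ a) (hb : b' ≤ b)
    (hc : c ≤ c') : AddLE a' b' c' := by
  obtain ⟨s, hs, hsc⟩ := h
  obtain ⟨t, ht, hts⟩ := exists_add_le ha hs
  obtain ⟨r, hr, hrt⟩ := exists_add_le hb (mem_comm ht)
  exact ⟨r, mem_comm hr, hrt.trans (hts.trans (hsc.trans hc))⟩

theorem AddLE.symm {a b c : E} (h : AddLE a b c) : AddLE b a c := by
  obtain ⟨s, hs, hsc⟩ := h
  exact ⟨s, mem_comm hs, hsc⟩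

theorem addLE_of_mem {a b c : E} (h : c ∈ add a b) : AddLE a b c := ⟨c, h, le_rfl⟩

theorem AddLE.right_le {a b c : E} (h : AddLE a b c) : b ≤ c := by
  obtain ⟨s, hs, hsc⟩ := h
  exact le_trans ⟨a, mem_comm hs⟩ hsc

theorem AddLE.left_le {a b c : E} (h : AddLE a b c) : a ≤ c := h.symm.right_le

theorem addLE_zero {a b : E} (h : a ≤ b) : AddLE a (zero : E) b := ⟨a, mem_zero a, h⟩

theorem zero_addLE {a b : E} (h : a ≤ b) : AddLE (zero : E) a b := ⟨a, zero_mem a, h⟩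

/-- If `a ⊕ b ≤ x` and `x ⊕ c ≤ d`, then `b ⊕ c` is defined, and `a ⊕ (b ⊕ c) ≤ d`. -/
theorem AddLE.assoc_right {a b c x d : E} (h : AddLE a b x) (h' : AddLE x c d) :
    ∃ y, y ∈ add b c ∧ AddLE a y d := by
  obtain ⟨s, hs, hsx⟩ := h
  obtain ⟨t, ht, htd⟩ := h'.mono hsx le_rfl le_rfl
  obtain ⟨r, hr, hr'⟩ := PartialCommMonoid.assoc_right hs ht
  exact ⟨r, hr, t, hr', htd⟩

theorem AddLE.assoc_left {a b c y d : E} (h : AddLE b c y) (h' : AddLE a y d) :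
    ∃ x, x ∈ add a b ∧ AddLE x c d := by
  obtain ⟨s, hs, hsx⟩ := h
  obtain ⟨t, ht, htd⟩ := h'.mono le_rfl hsx le_rfl
  obtain ⟨r, hr, hr'⟩ := PartialCommMonoid.assoc_left hs ht
  exact ⟨r, hr, t, hr', htd⟩

theorem le_of_mem_of_addLE {a b s c : E} (h : s ∈ add a b) (h' : AddLE a b c) : s ≤ c := by
  obtain ⟨t, ht, htc⟩ := h'
  rwa [Part.mem_unique h ht]

end PartialCommMonoid

/-! ### `Bool`-promonoidal categories -/

/-- A `Bool`-profunctor from `C` to `D`: a functor `Cᵒᵖ × D ⥤ Bool`, where the poset of truth values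
is `Prop`. -/
abbrev BoolProfunctor (C : Type v) [Category.{w} C] (D : Type v') [Category.{w'} D] :=
  Cᵒᵖ × D ⥤ Prop

/-- A `Bool`-promonoidal structure on a category: `Bool`-profunctors from `C × C` and from the
terminal category to `C`, associative and unital for relational composition. The identity
`Bool`-profunctor relates `a` and `b` when there is a morphism `a ⟶ b`. -/
structure BoolPromonoidal (C : Type v) [Category.{w} C] where
  P : BoolProfunctor (C × C) C
  I : BoolProfunctor (Discrete PUnit.{1}) C
  assoc : ∀ a b c d : C,
    (∃ x, P.obj (op (a, b), x) ∧ P.obj (op (x, c), d)) ↔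
      (∃ x, P.obj (op (b, c), x) ∧ P.obj (op (a, x), d))
  right_unit : ∀ a b : C,
    (∃ x, I.obj (op ⟨PUnit.unit⟩, x) ∧ P.obj (op (a, x), b)) ↔ Nonempty (a ⟶ b)
  left_unit : ∀ a b : C,
    (∃ x, I.obj (op ⟨PUnit.unit⟩, x) ∧ P.obj (op (x, a), b)) ↔ Nonempty (a ⟶ b)

open PartialCommMonoid

/-- A partial commutative monoid as a thin `Bool`-promonoidal category, on its extension preorder:
`P(a, b; c)` holds iff `a ⊕ b ≤ c`, and `I(c)` always holds. -/
def promonoidal (E : Type u) [PartialCommMonoid E] : BoolPromonoidal E where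
  P :=
    { obj := fun p => AddLE p.1.unop.1 p.1.unop.2 p.2
      map := fun f => homOfLE fun h =>
        AddLE.mono h (leOfHom f.1.unop.1) (leOfHom f.1.unop.2) (leOfHom f.2) }
  I :=
    { obj := fun _ => True
      map := fun _ => 𝟙 _ }
  assoc := by
    intro a b c d
    constructor
    · rintro ⟨x, h, h'⟩
      obtain ⟨y, hy, hy'⟩ := AddLE.assoc_right h h'
      exact ⟨y, addLE_of_mem hy, hy'⟩
    · rintro ⟨x, h, h'⟩
      obtain ⟨y, hy, hy'⟩ := AddLE.assoc_left h h'
      exact ⟨y, addLE_of_mem hy, hy'⟩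
  right_unit := by
    intro a b
    constructor
    · rintro ⟨x, -, h⟩
      exact ⟨homOfLE (AddLE.left_le h)⟩
    · rintro ⟨f⟩
      exact ⟨zero, trivial, addLE_zero (leOfHom f)⟩
  left_unit := by
    intro a b
    constructor
    · rintro ⟨x, -, h⟩
      exact ⟨homOfLE (AddLE.right_le h)⟩
    · rintro ⟨f⟩
      exact ⟨zero, trivial, zero_addLE (leOfHom f)⟩

/-! ### Copresheaves on the grades -/

/-- The category `[𝐄, Set]` of functors from the extension preorder to sets, and natural
transformations. It is not an abbreviation, because its default monoidal structure will be the
convolution structure instead of the pointwise one. -/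
def Copresheaf (E : Type u) [PartialCommMonoid E] := E ⥤ Type u

namespace Copresheaf

variable {E : Type u} [PartialCommMonoid E]

instance : Category (Copresheaf E) := inferInstanceAs (Category (E ⥤ Type u))

/-- The set of elements of grade `a`. -/
def El (F : Copresheaf E) (a : E) : Type u := CategoryTheory.Functor.obj F a

/-- The action `F(a ≤ b)`. -/
def reg (F : Copresheaf E) {a b : E} (h : a ≤ b) (x : F.El a) : F.El b :=
  CategoryTheory.Functor.map F (homOfLE h) x

/-- The component of a natural transformation at a grade, as a function. -/
def app {F G : Copresheaf E} (α : F ⟶ G) (a : E) (x : F.El a) : G.El a :=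
  NatTrans.app α a x

@[simp] theorem reg_self (F : Copresheaf E) {a : E} (h : a ≤ a) (x : F.El a) : F.reg h x = x := by
  have : homOfLE h = 𝟙 a := rfl
  simp only [reg, this]
  erw [CategoryTheory.Functor.map_id]
  rfl

@[simp] theorem reg_reg (F : Copresheaf E) {a b c : E} (h : a ≤ b) (h' : b ≤ c) (x : F.El a) :
    F.reg h' (F.reg h x) = F.reg (h.trans h') x := by
  have : homOfLE (h.trans h') = homOfLE h ≫ homOfLE h' := rfl
  simp only [reg, this]
  exact (congrArg (fun f : CategoryTheory.Functor.obj F a ⟶ CategoryTheory.Functor.obj F c => f x)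
    (CategoryTheory.Functor.map_comp F (homOfLE h) (homOfLE h'))).symm

/-- A copresheaf from its sets and its action. -/
def mk (X : E → Type u) (r : ∀ {a b : E}, a ≤ b → X a → X b) (r_self : ∀ a (x : X a), r le_rfl x = x)
    (r_r : ∀ {a b c : E} (h : a ≤ b) (h' : b ≤ c) (x : X a), r h' (r h x) = r (h.trans h') x) :
    Copresheaf E :=
  { obj := X
    map := fun f => TypeCat.ofHom (r (leOfHom f))
    map_id := fun a => by ext x; exact r_self a x
    map_comp := fun f g => by ext x; exact (r_r (leOfHom f) (leOfHom g) x).symm : E ⥤ Type u }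

/-- A natural transformation from its components. -/
def homMk {F G : Copresheaf E} (f : ∀ a, F.El a → G.El a)
    (nat : ∀ {a b : E} (h : a ≤ b) (x : F.El a), f b (F.reg h x) = G.reg h (f a x)) : F ⟶ G :=
  NatTrans.mk (F := (F : E ⥤ Type u)) (G := (G : E ⥤ Type u)) (fun a => TypeCat.ofHom (f a))
    (fun _ _ h => by ext x; exact nat (leOfHom h) x)

@[simp] theorem app_homMk {F G : Copresheaf E} (f : ∀ a, F.El a → G.El a) (nat) (a : E)
    (x : F.El a) : app (homMk (F := F) (G := G) f nat) a x = f a x := rfl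

@[simp] theorem app_id (F : Copresheaf E) (a : E) (x : F.El a) : app (𝟙 F) a x = x := rfl

@[simp] theorem app_comp {F G H : Copresheaf E} (α : F ⟶ G) (β : G ⟶ H) (a : E) (x : F.El a) :
    app (α ≫ β) a x = app β a (app α a x) := rfl

theorem app_reg {F G : Copresheaf E} (α : F ⟶ G) {a b : E} (h : a ≤ b) (x : F.El a) :
    app α b (F.reg h x) = G.reg h (app α a x) := by
  have := NatTrans.naturality (F := (F : E ⥤ Type u)) (G := (G : E ⥤ Type u)) α (homOfLE h)
  exact congrArg (fun f : F.obj a ⟶ G.obj b => f x) this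

theorem hom_ext {F G : Copresheaf E} {α β : F ⟶ G} (h : ∀ a x, app α a x = app β a x) :
    α = β := by
  apply NatTrans.ext
  funext a
  ext x
  exact h a x

/-! ### The convolution monoidal structure -/

/-- The elements of `∐_{a ⊕ b ≤ c} F(a) × G(b)`. -/
structure ConvPair (F G : Copresheaf E) (c : E) where
  a : E
  b : E
  h : (promonoidal E).P.obj (op (a, b), c)
  x : F.El a
  y : G.El b

/-- The generating pairs `(a, b, x, y) ∼ (a', b', F(a ≤ a')(x), G(b ≤ b')(y))`. -/
inductive ConvRel (F G : Copresheaf E) (c : E) : ConvPair F G c → ConvPair F G c → Prop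
  | step {a b a' b' : E} (ha : a ≤ a') (hb : b ≤ b')
      (h : (promonoidal E).P.obj (op (a, b), c)) (h' : (promonoidal E).P.obj (op (a', b'), c))
      (x : F.El a) (y : G.El b) :
      ConvRel F G c ⟨a, b, h, x, y⟩ ⟨a', b', h', F.reg ha x, G.reg hb y⟩

/-- The set `(F ∗ G)(c)`: the quotient by the equivalence relation generated by `ConvRel`. -/
def ConvEl (F G : Copresheaf E) (c : E) : Type u := Quot (ConvRel F G c)

/-- The class of `(a, b, x, y)`. -/
def tmk {F G : Copresheaf E} {a b c : E} (h : AddLE a b c) (x : F.El a) (y : G.El b) :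
    ConvEl F G c := Quot.mk _ ⟨a, b, h, x, y⟩

theorem tmk_reg {F G : Copresheaf E} {a b a' b' c : E} (ha : a ≤ a') (hb : b ≤ b')
    (h' : AddLE a' b' c) (x : F.El a) (y : G.El b) :
    tmk h' (F.reg ha x) (G.reg hb y) = tmk (h'.mono ha hb le_rfl) x y :=
  (Quot.sound (ConvRel.step ha hb (h'.mono ha hb le_rfl) h' x y)).symm

theorem tmk_reg_left {F G : Copresheaf E} {a b a' c : E} (ha : a ≤ a')
    (h' : AddLE a' b c) (x : F.El a) (y : G.El b) :
    tmk h' (F.reg ha x) y = tmk (h'.mono ha le_rfl le_rfl) x y := by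
  simpa using tmk_reg ha le_rfl h' x y

theorem tmk_reg_right {F G : Copresheaf E} {a b b' c : E} (hb : b ≤ b')
    (h' : AddLE a b' c) (x : F.El a) (y : G.El b) :
    tmk h' x (G.reg hb y) = tmk (h'.mono le_rfl hb le_rfl) x y := by
  simpa using tmk_reg le_rfl hb h' x y

theorem ConvEl.ind {F G : Copresheaf E} {c : E} {p : ConvEl F G c → Prop}
    (H : ∀ (a b : E) (h : AddLE a b c) (x : F.El a) (y : G.El b), p (tmk h x y)) (t) : p t := by
  induction t using Quot.ind with
  | mk t => exact H t.a t.b t.h t.x t.y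

/-- Functions out of `(F ∗ G)(c)`. -/
def ConvEl.lift {F G : Copresheaf E} {c : E} {T : Type u}
    (f : ∀ (a b : E), AddLE a b c → F.El a → G.El b → T)
    (hf : ∀ {a b a' b' : E} (ha : a ≤ a') (hb : b ≤ b') (h' : AddLE a' b' c) (x : F.El a)
      (y : G.El b), f a' b' h' (F.reg ha x) (G.reg hb y) = f a b (h'.mono ha hb le_rfl) x y)
    (t : ConvEl F G c) : T :=
  Quot.lift (fun t => f t.a t.b t.h t.x t.y)
    (by rintro _ _ ⟨ha, hb, h, h', x, y⟩; exact (hf ha hb h' x y).symm) t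

@[simp] theorem ConvEl.lift_tmk {F G : Copresheaf E} {c : E} {T : Type u}
    (f : ∀ (a b : E), AddLE a b c → F.El a → G.El b → T) (hf) {a b : E} (h : AddLE a b c)
    (x : F.El a) (y : G.El b) : ConvEl.lift f hf (tmk h x y) = f a b h x y := rfl

/-- The convolution `F ∗ G`. -/
def conv (F G : Copresheaf E) : Copresheaf E :=
  mk (ConvEl F G)
    (fun h => ConvEl.lift (fun _ _ h' x y => tmk (h'.mono le_rfl le_rfl h) x y)
      (fun ha hb h' x y => tmk_reg ha hb _ x y))
    (fun _ x => by induction x using ConvEl.ind; rfl)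
    (fun _ _ x => by induction x using ConvEl.ind; rfl)

/-- The class of `(a, b, x, y)`, as an element of the copresheaf `F ∗ G`. -/
def pair {F G : Copresheaf E} {a b c : E} (h : AddLE a b c) (x : F.El a) (y : G.El b) :
    (conv F G).El c := tmk h x y

theorem conv_ind {F G : Copresheaf E} {c : E} {p : (conv F G).El c → Prop}
    (H : ∀ (a b : E) (h : AddLE a b c) (x : F.El a) (y : G.El b), p (pair h x y)) (t) : p t :=
  ConvEl.ind H t

@[simp] theorem reg_pair {F G : Copresheaf E} {a b c c' : E} (hc : c ≤ c') (h : AddLE a b c)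
    (x : F.El a) (y : G.El b) :
    (conv F G).reg hc (pair h x y) = pair (h.mono le_rfl le_rfl hc) x y := rfl

theorem pair_reg {F G : Copresheaf E} {a b a' b' c : E} (ha : a ≤ a') (hb : b ≤ b')
    (h' : AddLE a' b' c) (x : F.El a) (y : G.El b) :
    pair h' (F.reg ha x) (G.reg hb y) = pair (h'.mono ha hb le_rfl) x y :=
  tmk_reg ha hb h' x y

theorem pair_reg_left {F G : Copresheaf E} {a b a' c : E} (ha : a ≤ a')
    (h' : AddLE a' b c) (x : F.El a) (y : G.El b) :
    pair h' (F.reg ha x) y = pair (h'.mono ha le_rfl le_rfl) x y :=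
  tmk_reg_left ha h' x y

theorem pair_reg_right {F G : Copresheaf E} {a b b' c : E} (hb : b ≤ b')
    (h' : AddLE a b' c) (x : F.El a) (y : G.El b) :
    pair h' x (G.reg hb y) = pair (h'.mono le_rfl hb le_rfl) x y :=
  tmk_reg_right hb h' x y

/-- Natural transformations out of `F ∗ G`. -/
def convDesc {F G H : Copresheaf E}
    (f : ∀ (a b c : E), AddLE a b c → F.El a → G.El b → H.El c)
    (hf : ∀ {a b a' b' c : E} (ha : a ≤ a') (hb : b ≤ b') (h' : AddLE a' b' c) (x : F.El a)
      (y : G.El b), f a' b' c h' (F.reg ha x) (G.reg hb y) = f a b c (h'.mono ha hb le_rfl) x y)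
    (nat : ∀ {a b c c' : E} (hc : c ≤ c') (h : AddLE a b c) (x : F.El a) (y : G.El b),
      f a b c' (h.mono le_rfl le_rfl hc) x y = H.reg hc (f a b c h x y)) :
    conv F G ⟶ H :=
  homMk (fun c => ConvEl.lift (fun a b h x y => f a b c h x y) (fun ha hb h' x y => hf ha hb h' x y))
    (fun hc t => by
      induction t using conv_ind with
      | H a b h x y => exact nat hc h x y)

@[simp] theorem app_convDesc {F G H : Copresheaf E}
    (f : ∀ (a b c : E), AddLE a b c → F.El a → G.El b → H.El c) (hf) (nat) {a b c : E}
    (h : AddLE a b c) (x : F.El a) (y : G.El b) :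
    app (convDesc f hf nat) c (pair h x y) = f a b c h x y := rfl

theorem conv_hom_ext {F G H : Copresheaf E} {α β : conv F G ⟶ H}
    (h : ∀ (a b c : E) (h : AddLE a b c) (x : F.El a) (y : G.El b),
      app α c (pair h x y) = app β c (pair h x y)) : α = β :=
  hom_ext fun c t => by
    induction t using conv_ind with
    | H a b h' x y => exact h a b c h' x y

/-- The action of convolution on natural transformations. -/
def convMap {F G F' G' : Copresheaf E} (α : F ⟶ F') (β : G ⟶ G') : conv F G ⟶ conv F' G' :=
  convDesc (fun a b _ h x y => pair h (app α a x) (app β b y))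
    (fun ha hb h' x y => by rw [app_reg, app_reg, pair_reg])
    (fun _ _ _ _ => rfl)

@[simp] theorem app_convMap {F G F' G' : Copresheaf E} (α : F ⟶ F') (β : G ⟶ G') {a b c : E}
    (h : AddLE a b c) (x : F.El a) (y : G.El b) :
    app (convMap α β) c (pair h x y) = pair h (app α a x) (app β b y) := rfl

/-- The convolution unit `J`, with `J(c) = {*}`. -/
def convUnit (E : Type u) [PartialCommMonoid E] : Copresheaf E :=
  mk (fun _ => PUnit) (fun _ x => x) (fun _ _ => rfl) (fun _ _ _ => rfl)

/-- The element of `J(c)`. -/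
def star (c : E) : (convUnit E).El c := PUnit.unit

theorem reg_star {a b : E} (h : a ≤ b) : (convUnit E).reg h (star a) = star b := rfl

theorem eq_star {a : E} (t : (convUnit E).El a) : t = star a := rfl

theorem pair_congr_middle {F G H : Copresheaf E} {a b c d y y' : E} (hy : y ∈ add b c)
    (h1 : AddLE b c y') (h2 : AddLE a y' d) (h3 : AddLE a y d)
    (f : F.El a) (g : G.El b) (k : H.El c) :
    (pair h2 f (pair h1 g k) : (conv F (conv G H)).El d) = pair h3 f (pair (addLE_of_mem hy) g k) := by
  have hle : y ≤ y' := le_of_mem_of_addLE hy h1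
  have : (pair h1 g k : (conv G H).El y') = (conv G H).reg hle (pair (addLE_of_mem hy) g k) := rfl
  rw [this, pair_reg_right]

theorem pair_congr_middle' {F G H : Copresheaf E} {a b c d x x' : E} (hx : x ∈ add a b)
    (h1 : AddLE a b x') (h2 : AddLE x' c d) (h3 : AddLE x c d)
    (f : F.El a) (g : G.El b) (k : H.El c) :
    (pair h2 (pair h1 f g) k : (conv (conv F G) H).El d) =
      pair h3 (pair (addLE_of_mem hx) f g) k := by
  have hle : x ≤ x' := le_of_mem_of_addLE hx h1
  have : (pair h1 f g : (conv F G).El x') = (conv F G).reg hle (pair (addLE_of_mem hx) f g) := rfl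
  rw [this, pair_reg_left]

/-- The associator of convolution: `[[f, g], k] ↦ [f, [g, k]]`. -/
noncomputable def convAssocHom (F G H : Copresheaf E) :
    conv (conv F G) H ⟶ conv F (conv G H) :=
  convDesc
    (fun _ _ _ h t k => ConvEl.lift
      (fun _ _ h' f g => pair (AddLE.assoc_right h' h).choose_spec.2 f
        (pair (addLE_of_mem (AddLE.assoc_right h' h).choose_spec.1) g k))
      (fun ha hb h' f g => by
        rw [pair_reg_left, pair_reg_left]
        exact pair_congr_middle (AddLE.assoc_right (h'.mono ha hb le_rfl) h).choose_spec.1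
          _ _ _ _ _ _) t)
    (fun ha hb h' t k => by
      induction t using conv_ind with
      | H a b h f g =>
        refine Eq.trans ?_ (pair_congr_middle (AddLE.assoc_right h (h'.mono ha hb le_rfl)).choose_spec.1
          (AddLE.mono (addLE_of_mem (AddLE.assoc_right (h.mono le_rfl le_rfl ha) h').choose_spec.1)
            le_rfl hb le_rfl) (AddLE.assoc_right (h.mono le_rfl le_rfl ha) h').choose_spec.2 _ f g k)
        exact congrArg (fun t => pair _ f t) (pair_reg_right hb _ g k))
    (fun hc h t k => by
      induction t using conv_ind with
      | H a b h' f g =>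
        exact (pair_congr_middle (AddLE.assoc_right h' (h.mono le_rfl le_rfl hc)).choose_spec.1
          (addLE_of_mem (AddLE.assoc_right h' h).choose_spec.1)
          ((AddLE.assoc_right h' h).choose_spec.2.mono le_rfl le_rfl hc)
          (AddLE.assoc_right h' (h.mono le_rfl le_rfl hc)).choose_spec.2 f g k).symm)

theorem app_convAssocHom {F G H : Copresheaf E} {a b c x y d : E} (h1 : AddLE a b x)
    (h2 : AddLE x c d) (h3 : AddLE b c y) (h4 : AddLE a y d) (f : F.El a) (g : G.El b)
    (k : H.El c) :
    app (convAssocHom F G H) d (pair h2 (pair h1 f g) k) = pair h4 f (pair h3 g k) :=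
  (pair_congr_middle (AddLE.assoc_right h1 h2).choose_spec.1 h3 h4 _ f g k).symm

/-- The inverse associator of convolution: `[f, [g, k]] ↦ [[f, g], k]`. -/
noncomputable def convAssocInv (F G H : Copresheaf E) :
    conv F (conv G H) ⟶ conv (conv F G) H :=
  convDesc
    (fun _ _ _ h f t => ConvEl.lift
      (fun _ _ h' g k => pair (AddLE.assoc_left h' h).choose_spec.2
        (pair (addLE_of_mem (AddLE.assoc_left h' h).choose_spec.1) f g) k)
      (fun ha hb h' g k => by
        rw [pair_reg_right, pair_reg_right]
        exact pair_congr_middle' (AddLE.assoc_left (h'.mono ha hb le_rfl) h).choose_spec.1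
          _ _ _ _ _ _) t)
    (fun ha hb h' f t => by
      induction t using conv_ind with
      | H a b h g k =>
        refine Eq.trans ?_ (pair_congr_middle' (AddLE.assoc_left h (h'.mono ha hb le_rfl)).choose_spec.1
          (AddLE.mono (addLE_of_mem (AddLE.assoc_left (h.mono le_rfl le_rfl hb) h').choose_spec.1)
            ha le_rfl le_rfl) (AddLE.assoc_left (h.mono le_rfl le_rfl hb) h').choose_spec.2 _ f g k)
        exact congrArg (fun t => pair _ t k) (pair_reg_left ha _ f g))
    (fun hc h f t => by
      induction t using conv_ind with
      | H a b h' g k =>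
        exact (pair_congr_middle' (AddLE.assoc_left h' (h.mono le_rfl le_rfl hc)).choose_spec.1
          (addLE_of_mem (AddLE.assoc_left h' h).choose_spec.1)
          ((AddLE.assoc_left h' h).choose_spec.2.mono le_rfl le_rfl hc)
          (AddLE.assoc_left h' (h.mono le_rfl le_rfl hc)).choose_spec.2 f g k).symm)

theorem app_convAssocInv {F G H : Copresheaf E} {a b c x y d : E} (h1 : AddLE a b x)
    (h2 : AddLE x c d) (h3 : AddLE b c y) (h4 : AddLE a y d) (f : F.El a) (g : G.El b)
    (k : H.El c) :
    app (convAssocInv F G H) d (pair h4 f (pair h3 g k)) = pair h2 (pair h1 f g) k :=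
  (pair_congr_middle' (AddLE.assoc_left h3 h4).choose_spec.1 h1 h2 _ f g k).symm

theorem conv_hom_ext₃ {F G H K : Copresheaf E} {α β : conv (conv F G) H ⟶ K}
    (h : ∀ (a b c x y d : E) (h1 : AddLE a b x) (h2 : AddLE x c d) (_ : y ∈ add b c)
      (_ : AddLE b c y) (_ : AddLE a y d) (f : F.El a) (g : G.El b) (k : H.El c),
      app α d (pair h2 (pair h1 f g) k) = app β d (pair h2 (pair h1 f g) k)) : α = β := by
  apply conv_hom_ext
  intro x c d h2 t k
  induction t using conv_ind with
  | H a b h1 f g =>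
    obtain ⟨y, h3, h4⟩ := AddLE.assoc_right h1 h2
    exact h a b c x y d h1 h2 h3 (addLE_of_mem h3) h4 f g k

theorem conv_hom_ext₃' {F G H K : Copresheaf E} {α β : conv F (conv G H) ⟶ K}
    (h : ∀ (a b c x y d : E) (_ : AddLE a b x) (_ : AddLE x c d) (h3 : AddLE b c y)
      (h4 : AddLE a y d) (f : F.El a) (g : G.El b) (k : H.El c),
      app α d (pair h4 f (pair h3 g k)) = app β d (pair h4 f (pair h3 g k))) : α = β := by
  apply conv_hom_ext
  intro a y d h4 f t
  induction t using conv_ind with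
  | H b c h3 g k =>
    obtain ⟨x, h1, h2⟩ := AddLE.assoc_left h3 h4
    exact h a b c x y d (addLE_of_mem h1) h2 h3 h4 f g k

/-- The associator of convolution. -/
noncomputable def convAssoc (F G H : Copresheaf E) : conv (conv F G) H ≅ conv F (conv G H) where
  hom := convAssocHom F G H
  inv := convAssocInv F G H
  hom_inv_id := conv_hom_ext₃ fun a b c x y d h1 h2 _ h3 h4 f g k => by
    rw [app_comp, app_convAssocHom h1 h2 h3 h4, app_convAssocInv h1 h2 h3 h4]; rfl
  inv_hom_id := conv_hom_ext₃' fun a b c x y d h1 h2 h3 h4 f g k => by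
    rw [app_comp, app_convAssocInv h1 h2 h3 h4, app_convAssocHom h1 h2 h3 h4]; rfl

/-- The left unitor of convolution: `[*, x] ↦ x`, regraded. -/
def convLeftUnitor (F : Copresheaf E) : conv (convUnit E) F ≅ F where
  hom := convDesc (fun _ _ _ h _ x => F.reg h.right_le x) (fun _ _ _ _ _ => by simp)
    (fun _ _ _ _ => by simp)
  inv := homMk (fun _ x => pair (zero_addLE le_rfl) (star zero) x)
    (fun h x => by rw [pair_reg_right]; rfl)
  hom_inv_id := conv_hom_ext fun a b c h x y => by
    simp only [app_comp, app_convDesc, app_homMk, app_id, pair_reg_right]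
    rw [eq_star x, ← reg_star (zero_le' a), pair_reg_left]
  inv_hom_id := hom_ext fun a x => by simp

/-- The right unitor of convolution: `[x, *] ↦ x`, regraded. -/
def convRightUnitor (F : Copresheaf E) : conv F (convUnit E) ≅ F where
  hom := convDesc (fun _ _ _ h x _ => F.reg h.left_le x) (fun _ _ _ _ _ => by simp)
    (fun _ _ _ _ => by simp)
  inv := homMk (fun _ x => pair (addLE_zero le_rfl) x (star zero))
    (fun h x => by rw [pair_reg_left]; rfl)
  hom_inv_id := conv_hom_ext fun a b c h x y => by
    simp only [app_comp, app_convDesc, app_homMk, app_id, pair_reg_left]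
    rw [eq_star y, ← reg_star (zero_le' b), pair_reg_right]
  inv_hom_id := hom_ext fun a x => by simp

/-- The convolution monoidal structure `(∗, J)`. -/
noncomputable instance convMonoidal : MonoidalCategory (Copresheaf E) where
  tensorObj := conv
  tensorHom := convMap
  whiskerLeft F _ _ α := convMap (𝟙 F) α
  whiskerRight α G := convMap α (𝟙 G)
  tensorUnit := convUnit E
  associator := convAssoc
  leftUnitor := convLeftUnitor
  rightUnitor := convRightUnitor
  tensorHom_def _ _ := conv_hom_ext fun _ _ _ _ _ _ => rfl
  id_tensorHom_id _ _ := conv_hom_ext fun _ _ _ _ _ _ => rfl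
  tensorHom_comp_tensorHom _ _ _ _ := conv_hom_ext fun _ _ _ _ _ _ => rfl
  whiskerLeft_id _ _ := conv_hom_ext fun _ _ _ _ _ _ => rfl
  id_whiskerRight _ _ := conv_hom_ext fun _ _ _ _ _ _ => rfl
  associator_naturality α β γ := conv_hom_ext₃ fun a b c x y d h1 h2 _ h3 h4 f g k => by
    simp only [app_comp, app_convMap, convAssoc, app_convAssocHom h1 h2 h3 h4]
  leftUnitor_naturality α := conv_hom_ext fun a b c h x y => by
    simp only [app_comp, app_convMap, convLeftUnitor, app_convDesc, app_reg]
  rightUnitor_naturality α := conv_hom_ext fun a b c h x y => by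
    simp only [app_comp, app_convMap, convRightUnitor, app_convDesc, app_reg]
  pentagon W X Y Z := conv_hom_ext fun p d e h3 t z => by
    induction t using conv_ind with
    | H q c h2 t y =>
      induction t using conv_ind with
      | H a b h1 w x =>
        obtain ⟨u, hu, hau⟩ := AddLE.assoc_right h1 h2
        obtain ⟨s, hs, hqs⟩ := AddLE.assoc_right h2 h3
        obtain ⟨t, ht, hat⟩ := AddLE.assoc_right h1 hqs
        obtain ⟨u', hu', hut⟩ := AddLE.assoc_left (addLE_of_mem hs) (addLE_of_mem ht)
        obtain rfl := Part.mem_unique hu hu'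
        have hu := addLE_of_mem hu
        have hs := addLE_of_mem hs
        have ht := addLE_of_mem ht
        simp only [app_comp, app_convMap, convAssoc, app_id, app_convAssocHom h1 h2 hu hau,
          app_convAssocHom hau h3 hut hat, app_convAssocHom hu hut hs ht,
          app_convAssocHom h2 h3 hs hqs, app_convAssocHom h1 hqs ht hat]
  triangle X Y := conv_hom_ext₃ fun a b c x y d h1 h2 _ h3 h4 f g k => by
    simp only [app_comp, app_convMap, convAssoc, app_id, app_convAssocHom h1 h2 h3 h4,
      convLeftUnitor, convRightUnitor, app_convDesc, pair_reg_left, pair_reg_right]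

end Copresheaf
/-! ### Duoidal categories -/

/-- A second monoidal structure on a category, written `(⊚, seqUnit)`. -/
class SeqMonoidal (V : Type v) [Category.{w} V] where
  str : MonoidalCategory V

section Seq

variable {V : Type v} [Category.{w} V] [SeqMonoidal V]

/-- The second tensor product. -/
def seqObj (A B : V) : V := (SeqMonoidal.str (V := V)).tensorObj A B

infixr:70 " ⊚ " => seqObj

/-- The second tensor product of morphisms. -/
def seqHom {A B A' B' : V} (f : A ⟶ A') (g : B ⟶ B') : A ⊚ B ⟶ A' ⊚ B' :=
  (SeqMonoidal.str (V := V)).tensorHom f g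

/-- The second unit object. -/
def seqUnit (V : Type v) [Category.{w} V] [SeqMonoidal V] : V :=
  (SeqMonoidal.str (V := V)).tensorUnit

/-- The second associator. -/
def seqAssoc (A B C : V) : (A ⊚ B) ⊚ C ≅ A ⊚ (B ⊚ C) :=
  (SeqMonoidal.str (V := V)).associator A B C

/-- The second left unitor. -/
def seqLeftUnitor (A : V) : seqUnit V ⊚ A ≅ A := (SeqMonoidal.str (V := V)).leftUnitor A

/-- The second right unitor. -/
def seqRightUnitor (A : V) : A ⊚ seqUnit V ≅ A := (SeqMonoidal.str (V := V)).rightUnitor A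

end Seq

/-- A duoidal category: two monoidal structures `(⊗, 𝟙_ V)` and `(⊚, seqUnit V)`, such that the
functors `⊚` and `seqUnit V` are lax monoidal for `⊗`, and the associator and unitors of `⊚` are
monoidal natural transformations. -/
class Duoidal (V : Type v) [Category.{w} V] [MonoidalCategory V] [SeqMonoidal V] where
  /-- the interchange law -/
  interchange (A B C D : V) : (A ⊚ B) ⊗ (C ⊚ D) ⟶ (A ⊗ C) ⊚ (B ⊗ D)
  /-- the comultiplication of the first unit -/
  split : 𝟙_ V ⟶ 𝟙_ V ⊚ 𝟙_ V
  /-- the multiplication of the second unit -/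
  merge : seqUnit V ⊗ seqUnit V ⟶ seqUnit V
  /-- the comparison of the units -/
  unitMap : 𝟙_ V ⟶ seqUnit V
  interchange_natural {A B C D A' B' C' D' : V} (f : A ⟶ A') (g : B ⟶ B') (h : C ⟶ C')
    (k : D ⟶ D') :
    (seqHom f g ⊗ₘ seqHom h k) ≫ interchange A' B' C' D' =
      interchange A B C D ≫ seqHom (f ⊗ₘ h) (g ⊗ₘ k)
  interchange_assoc (A B C D X Y : V) :
    (interchange A B C D ▷ (X ⊚ Y)) ≫ interchange (A ⊗ C) (B ⊗ D) X Y ≫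
        seqHom (α_ A C X).hom (α_ B D Y).hom =
      (α_ (A ⊚ B) (C ⊚ D) (X ⊚ Y)).hom ≫ ((A ⊚ B) ◁ interchange C D X Y) ≫
        interchange A B (C ⊗ X) (D ⊗ Y)
  interchange_left_unit (A B : V) :
    (λ_ (A ⊚ B)).hom = (split ▷ (A ⊚ B)) ≫ interchange (𝟙_ V) (𝟙_ V) A B ≫
      seqHom (λ_ A).hom (λ_ B).hom
  interchange_right_unit (A B : V) :
    (ρ_ (A ⊚ B)).hom = ((A ⊚ B) ◁ split) ≫ interchange A B (𝟙_ V) (𝟙_ V) ≫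
      seqHom (ρ_ A).hom (ρ_ B).hom
  merge_assoc :
    (merge ▷ seqUnit V) ≫ merge = (α_ _ _ _).hom ≫ (seqUnit V ◁ merge) ≫ merge
  merge_left_unit : (unitMap ▷ seqUnit V) ≫ merge = (λ_ (seqUnit V)).hom
  merge_right_unit : (seqUnit V ◁ unitMap) ≫ merge = (ρ_ (seqUnit V)).hom
  seqAssoc_tensor (A B C D X Y : V) :
    interchange (A ⊚ B) C (D ⊚ X) Y ≫ seqHom (interchange A B D X) (𝟙 (C ⊗ Y)) ≫
        (seqAssoc (A ⊗ D) (B ⊗ X) (C ⊗ Y)).hom =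
      ((seqAssoc A B C).hom ⊗ₘ (seqAssoc D X Y).hom) ≫ interchange A (B ⊚ C) D (X ⊚ Y) ≫
        seqHom (𝟙 (A ⊗ D)) (interchange B C X Y)
  seqAssoc_unit :
    split ≫ seqHom split (𝟙 (𝟙_ V)) ≫ (seqAssoc _ _ _).hom =
      split ≫ seqHom (𝟙 (𝟙_ V)) split
  seqLeftUnitor_tensor (A B : V) :
    interchange (seqUnit V) A (seqUnit V) B ≫ seqHom merge (𝟙 (A ⊗ B)) ≫
      (seqLeftUnitor (A ⊗ B)).hom = (seqLeftUnitor A).hom ⊗ₘ (seqLeftUnitor B).hom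
  seqLeftUnitor_unit :
    split ≫ seqHom unitMap (𝟙 (𝟙_ V)) ≫ (seqLeftUnitor (𝟙_ V)).hom = 𝟙 (𝟙_ V)
  seqRightUnitor_tensor (A B : V) :
    interchange A (seqUnit V) B (seqUnit V) ≫ seqHom (𝟙 (A ⊗ B)) merge ≫
      (seqRightUnitor (A ⊗ B)).hom = (seqRightUnitor A).hom ⊗ₘ (seqRightUnitor B).hom
  seqRightUnitor_unit :
    split ≫ seqHom (𝟙 (𝟙_ V)) unitMap ≫ (seqRightUnitor (𝟙_ V)).hom = 𝟙 (𝟙_ V)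

namespace Copresheaf

variable {E : Type u} [PartialCommMonoid E]

/-- The second monoidal structure on copresheaves: the pointwise cartesian one `(×, K)`, where
`(F × G)(e) = F(e) × G(e)` and `K` is constant at a singleton. -/
instance seqMonoidal : SeqMonoidal (Copresheaf E) where
  str := inferInstanceAs (MonoidalCategory (E ⥤ Type u))

/-- A pair, as an element of the pointwise product. -/
def prodMk {F G : Copresheaf E} {a : E} (x : F.El a) (y : G.El a) : (F ⊚ G).El a := (x, y)

/-- The first component. -/
def fst {F G : Copresheaf E} {a : E} (t : (F ⊚ G).El a) : F.El a := t.1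

/-- The second component. -/
def snd {F G : Copresheaf E} {a : E} (t : (F ⊚ G).El a) : G.El a := t.2

theorem prod_ind {F G : Copresheaf E} {a : E} {p : (F ⊚ G).El a → Prop}
    (H : ∀ x y, p (prodMk x y)) (t) : p t := H t.1 t.2

@[simp] theorem reg_prodMk {F G : Copresheaf E} {a b : E} (h : a ≤ b) (x : F.El a) (y : G.El a) :
    (F ⊚ G).reg h (prodMk x y) = prodMk (F.reg h x) (G.reg h y) := rfl

@[simp] theorem app_seqHom {F G F' G' : Copresheaf E} (α : F ⟶ F') (β : G ⟶ G') {a : E}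
    (x : F.El a) (y : G.El a) :
    app (seqHom α β) a (prodMk x y) = prodMk (app α a x) (app β a y) := rfl

@[simp] theorem app_seqAssoc {F G H : Copresheaf E} {a : E} (x : F.El a) (y : G.El a)
    (z : H.El a) :
    app (seqAssoc F G H).hom a (prodMk (prodMk x y) z) = prodMk x (prodMk y z) := rfl

/-- The element of `K(a)`. -/
def pt (a : E) : (seqUnit (Copresheaf E)).El a := PUnit.unit

@[simp] theorem reg_pt {a b : E} (h : a ≤ b) : (seqUnit (Copresheaf E)).reg h (pt a) = pt b := rfl

theorem eq_pt {a : E} (t : (seqUnit (Copresheaf E)).El a) : t = pt a := rfl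

@[simp] theorem app_seqLeftUnitor {F : Copresheaf E} {a : E} (x : F.El a) :
    app (seqLeftUnitor F).hom a (prodMk (pt a) x) = x := rfl

@[simp] theorem app_seqRightUnitor {F : Copresheaf E} {a : E} (x : F.El a) :
    app (seqRightUnitor F).hom a (prodMk x (pt a)) = x := rfl

/-- A pair, as an element of the convolution. -/
def tpair {F G : Copresheaf E} {a b c : E} (h : AddLE a b c) (x : F.El a) (y : G.El b) :
    (F ⊗ G).El c := pair h x y

theorem tensor_ind {F G : Copresheaf E} {c : E} {p : (F ⊗ G).El c → Prop}
    (H : ∀ (a b : E) (h : AddLE a b c) (x : F.El a) (y : G.El b), p (tpair h x y)) (t) : p t :=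
  conv_ind H t

@[simp] theorem app_tensorHom {F G F' G' : Copresheaf E} (α : F ⟶ F') (β : G ⟶ G') {a b c : E}
    (h : AddLE a b c) (x : F.El a) (y : G.El b) :
    app (α ⊗ₘ β) c (tpair h x y) = tpair h (app α a x) (app β b y) := rfl

@[simp] theorem app_whiskerRight {F G F' : Copresheaf E} (α : F ⟶ F') {a b c : E}
    (h : AddLE a b c) (x : F.El a) (y : G.El b) :
    app (α ▷ G) c (tpair h x y) = tpair h (app α a x) y := rfl

@[simp] theorem app_whiskerLeft {F G G' : Copresheaf E} (β : G ⟶ G') {a b c : E}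
    (h : AddLE a b c) (x : F.El a) (y : G.El b) :
    app (F ◁ β) c (tpair h x y) = tpair h x (app β b y) := rfl

@[simp] theorem reg_tpair {F G : Copresheaf E} {a b c c' : E} (hc : c ≤ c') (h : AddLE a b c)
    (x : F.El a) (y : G.El b) :
    (F ⊗ G).reg hc (tpair h x y) = tpair (h.mono le_rfl le_rfl hc) x y := rfl

theorem tpair_reg {F G : Copresheaf E} {a b a' b' c : E} (ha : a ≤ a') (hb : b ≤ b')
    (h' : AddLE a' b' c) (x : F.El a) (y : G.El b) :
    tpair h' (F.reg ha x) (G.reg hb y) = tpair (h'.mono ha hb le_rfl) x y :=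
  pair_reg ha hb h' x y

/-- The element of the convolution unit at grade `a`. -/
def tstar (a : E) : (𝟙_ (Copresheaf E)).El a := star a

theorem eq_tstar {a : E} (t : (𝟙_ (Copresheaf E)).El a) : t = tstar a := rfl

@[simp] theorem reg_tstar {a b : E} (h : a ≤ b) : (𝟙_ (Copresheaf E)).reg h (tstar a) = tstar b :=
  rfl

@[simp] theorem app_leftUnitor {F : Copresheaf E} {a b c : E} (h : AddLE a b c)
    (t : (𝟙_ (Copresheaf E)).El a) (x : F.El b) :
    app (λ_ F).hom c (tpair h t x) = F.reg h.right_le x := rfl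

@[simp] theorem app_rightUnitor {F : Copresheaf E} {a b c : E} (h : AddLE a b c)
    (x : F.El a) (t : (𝟙_ (Copresheaf E)).El b) :
    app (ρ_ F).hom c (tpair h x t) = F.reg h.left_le x := rfl

theorem app_associator {F G H : Copresheaf E} {a b c x y d : E} (h1 : AddLE a b x)
    (h2 : AddLE x c d) (h3 : AddLE b c y) (h4 : AddLE a y d) (f : F.El a) (g : G.El b)
    (k : H.El c) :
    app (α_ F G H).hom d (tpair h2 (tpair h1 f g) k) = tpair h4 f (tpair h3 g k) :=
  app_convAssocHom h1 h2 h3 h4 f g k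

/-- Natural transformations out of `F ∗ G`. -/
def tensorDesc {F G H : Copresheaf E}
    (f : ∀ (a b c : E), AddLE a b c → F.El a → G.El b → H.El c)
    (hf : ∀ {a b a' b' c : E} (ha : a ≤ a') (hb : b ≤ b') (h' : AddLE a' b' c) (x : F.El a)
      (y : G.El b), f a' b' c h' (F.reg ha x) (G.reg hb y) = f a b c (h'.mono ha hb le_rfl) x y)
    (nat : ∀ {a b c c' : E} (hc : c ≤ c') (h : AddLE a b c) (x : F.El a) (y : G.El b),
      f a b c' (h.mono le_rfl le_rfl hc) x y = H.reg hc (f a b c h x y)) :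
    F ⊗ G ⟶ H := convDesc f hf nat

@[simp] theorem app_tensorDesc {F G H : Copresheaf E}
    (f : ∀ (a b c : E), AddLE a b c → F.El a → G.El b → H.El c) (hf) (nat) {a b c : E}
    (h : AddLE a b c) (x : F.El a) (y : G.El b) :
    app (tensorDesc f hf nat) c (tpair h x y) = f a b c h x y := rfl

theorem tensor_hom_ext {F G H : Copresheaf E} {α β : F ⊗ G ⟶ H}
    (h : ∀ (a b c : E) (h : AddLE a b c) (x : F.El a) (y : G.El b),
      app α c (tpair h x y) = app β c (tpair h x y)) : α = β := conv_hom_ext h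

theorem tensor_hom_ext₃ {F G H K : Copresheaf E} {α β : (F ⊗ G) ⊗ H ⟶ K}
    (h : ∀ (a b c x y d : E) (h1 : AddLE a b x) (h2 : AddLE x c d)
      (_ : AddLE b c y) (_ : AddLE a y d) (f : F.El a) (g : G.El b) (k : H.El c),
      app α d (tpair h2 (tpair h1 f g) k) = app β d (tpair h2 (tpair h1 f g) k)) : α = β :=
  conv_hom_ext₃ fun a b c x y d h1 h2 _ => h a b c x y d h1 h2

/-- Copresheaves with convolution and the pointwise product form a duoidal category, with
interchange `[(f, g), (h, k)] ↦ ([f, h], [g, k])`. -/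
noncomputable instance duoidal : Duoidal (Copresheaf E) where
  interchange A B C D := tensorDesc
    (fun _ _ _ h (x : (A ⊚ B).El _) (y : (C ⊚ D).El _) =>
      prodMk (tpair h (fst x) (fst y)) (tpair h (snd x) (snd y)))
    (fun ha hb h' x y => by
            exact congrArg₂ prodMk (tpair_reg ha hb h' _ _) (tpair_reg ha hb h' _ _))
    (fun _ _ _ _ => rfl)
  split := homMk (fun a _ => prodMk (tstar a) (tstar a)) (fun _ _ => rfl)
  merge := tensorDesc (fun _ _ c _ _ _ => pt c) (fun _ _ _ _ _ => rfl) (fun _ _ _ _ => rfl)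
  unitMap := homMk (fun a _ => pt a) (fun _ _ => rfl)
  interchange_natural f g h k := tensor_hom_ext fun _ _ _ _ _ _ => rfl
  interchange_assoc A B C D X Y := tensor_hom_ext₃ fun a b c x y d h1 h2 h3 h4 f g k => by
    simp only [app_comp, app_whiskerRight, app_associator h1 h2 h3 h4,
      app_whiskerLeft]
    exact congrArg₂ prodMk (app_associator h1 h2 h3 h4 _ _ _) (app_associator h1 h2 h3 h4 _ _ _)
  interchange_left_unit A B := tensor_hom_ext fun _ _ _ _ _ _ => rfl
  interchange_right_unit A B := tensor_hom_ext fun _ _ _ _ _ _ => rfl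
  merge_assoc := hom_ext fun _ _ => rfl
  merge_left_unit := hom_ext fun _ _ => rfl
  merge_right_unit := hom_ext fun _ _ => rfl
  seqAssoc_tensor A B C D X Y := tensor_hom_ext fun _ _ _ _ _ _ => rfl
  seqAssoc_unit := hom_ext fun _ _ => rfl
  seqLeftUnitor_tensor A B := tensor_hom_ext fun _ _ _ _ _ _ => rfl
  seqLeftUnitor_unit := hom_ext fun _ _ => rfl
  seqRightUnitor_tensor A B := tensor_hom_ext fun _ _ _ _ _ _ => rfl
  seqRightUnitor_unit := hom_ext fun _ _ => rfl

end Copresheaf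

/-! ### Duoidally enriched Freyd categories -/

/-- A Freyd category over the monoidal category `M`, enriched in the duoidal category `V`: a functor
`Mᵒᵖ × M ⥤ V` of morphisms, with sequential identities and composition with respect to
`(⊚, seqUnit V)`, and with parallel composition and its unit with respect to `(⊗, 𝟙_ V)` (a lax
monoidal structure on the functor), related by the duoidal structure of `V`. -/
structure FreydCategory (V : Type v) [Category.{w} V] [MonoidalCategory V] [SeqMonoidal V]
    [Duoidal V] (M : Type v') [Category.{w'} M] [MonoidalCategory M] where
  hom : LaxMonoidalFunctor (Mᵒᵖ × M) V
  ident (X : M) : seqUnit V ⟶ hom.obj (op X, X)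
  comp (X Y Z : M) : hom.obj (op X, Y) ⊚ hom.obj (op Y, Z) ⟶ hom.obj (op X, Z)
  ident_natural {X Y : M} (f : X ⟶ Y) :
    ident X ≫ hom.map ((𝟙 (op X), f) : (op X, X) ⟶ (op X, Y)) =
      ident Y ≫ hom.map ((f.op, 𝟙 Y) : (op Y, Y) ⟶ (op X, Y))
  comp_natural_left {X X' : M} (f : X' ⟶ X) (Y Z : M) :
    comp X Y Z ≫ hom.map ((f.op, 𝟙 Z) : (op X, Z) ⟶ (op X', Z)) =
      seqHom (hom.map ((f.op, 𝟙 Y) : (op X, Y) ⟶ (op X', Y))) (𝟙 _) ≫ comp X' Y Z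
  comp_natural_right (X Y : M) {Z Z' : M} (f : Z ⟶ Z') :
    comp X Y Z ≫ hom.map ((𝟙 (op X), f) : (op X, Z) ⟶ (op X, Z')) =
      seqHom (𝟙 _) (hom.map ((𝟙 (op Y), f) : (op Y, Z) ⟶ (op Y, Z'))) ≫ comp X Y Z'
  comp_natural_middle (X : M) {Y Y' : M} (f : Y ⟶ Y') (Z : M) :
    seqHom (hom.map ((𝟙 (op X), f) : (op X, Y) ⟶ (op X, Y'))) (𝟙 _) ≫ comp X Y' Z =
      seqHom (𝟙 _) (hom.map ((f.op, 𝟙 Z) : (op Y', Z) ⟶ (op Y, Z))) ≫ comp X Y Z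
  id_comp (X Y : M) :
    seqHom (ident X) (𝟙 _) ≫ comp X X Y = (seqLeftUnitor (hom.obj (op X, Y))).hom
  comp_id (X Y : M) :
    seqHom (𝟙 _) (ident Y) ≫ comp X Y Y = (seqRightUnitor (hom.obj (op X, Y))).hom
  assoc (W X Y Z : M) :
    seqHom (comp W X Y) (𝟙 _) ≫ comp W Y Z =
      (seqAssoc _ _ _).hom ≫ seqHom (𝟙 _) (comp X Y Z) ≫ comp W X Z
  /-- the parallel unit is the sequential identity of the unit object -/
  unit_eq :
    Functor.LaxMonoidal.ε hom.toFunctor = Duoidal.unitMap ≫ ident (𝟙_ M)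
  /-- the parallel composite of identities is an identity -/
  ident_par (X Y : M) :
    (ident X ⊗ₘ ident Y) ≫ Functor.LaxMonoidal.μ hom.toFunctor (op X, X) (op Y, Y) =
      Duoidal.merge ≫ ident (X ⊗ Y)
  /-- interchange of sequential and parallel composition -/
  comp_par (X Y Z X' Y' Z' : M) :
    (comp X Y Z ⊗ₘ comp X' Y' Z') ≫
        Functor.LaxMonoidal.μ hom.toFunctor (op X, Z) (op X', Z') =
      Duoidal.interchange _ _ _ _ ≫
        seqHom (Functor.LaxMonoidal.μ hom.toFunctor (op X, Y) (op X', Y'))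
          (Functor.LaxMonoidal.μ hom.toFunctor (op Y, Z) (op Y', Z')) ≫
        comp (X ⊗ X') (Y ⊗ Y') (Z ⊗ Z')

/-! ### Lax monoidal functors `C_objᵒᵖ × C_obj → [𝐄, Set]`, with composition -/

/-- The monoidal category `C_objᵒᵖ × C_obj` for a monoid `C_obj`, seen as a discrete monoidal
category, with `(X, Y) ⊗ (X', Y') = (X ⊗ X', Y ⊗ Y')`. -/
abbrev ObjPair (C : Type u) := (Discrete C)ᵒᵖ × Discrete C

/-- The category of lax monoidal functors from `C_objᵒᵖ × C_obj` to `([𝐄, Set], ∗, J)`, and monoidal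
natural transformations. -/
abbrev LaxProf (E : Type u) [PartialCommMonoid E] (C : Type u) [Monoid C] :=
  LaxMonoidalFunctor (ObjPair C) (Copresheaf E)

namespace LaxProf

noncomputable section

open Copresheaf Functor.LaxMonoidal

variable {E : Type u} [PartialCommMonoid E] {C : Type u} [Monoid C]

instance subsingleton_hom (d d' : ObjPair C) : Subsingleton (d ⟶ d') :=
  ⟨fun _ _ => Prod.ext (Quiver.Hom.unop_inj (Subsingleton.elim _ _)) (Subsingleton.elim _ _)⟩

/-- The set of elements of a lax monoidal functor at a pair of objects and a grade. -/
abbrev At (P : LaxProf E C) (d : ObjPair C) (a : E) : Type u := (P.obj d).El a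

/-- The action on morphisms of `C_objᵒᵖ × C_obj`. -/
def tr (P : LaxProf E C) {d d' : ObjPair C} (f : d ⟶ d') {a : E} (x : P.At d a) : P.At d' a :=
  app (P.map f) a x

@[simp] theorem tr_self (P : LaxProf E C) {d : ObjPair C} (f : d ⟶ d) {a : E} (x : P.At d a) :
    P.tr f x = x := by
  rw [Subsingleton.elim f (𝟙 d), tr, CategoryTheory.Functor.map_id, app_id]

@[simp] theorem tr_tr (P : LaxProf E C) {d d' d'' : ObjPair C} (f : d ⟶ d') (g : d' ⟶ d'') {a : E}
    (x : P.At d a) : P.tr g (P.tr f x) = P.tr (f ≫ g) x := by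
  rw [tr, tr, tr, CategoryTheory.Functor.map_comp, app_comp]

theorem reg_tr (P : LaxProf E C) {d d' : ObjPair C} (f : d ⟶ d') {a b : E} (h : a ≤ b)
    (x : P.At d a) : (P.obj d').reg h (P.tr f x) = P.tr f ((P.obj d).reg h x) :=
  (app_reg _ h x).symm

/-- The lax unit, at a grade. -/
def eps (P : LaxProf E C) (a : E) : P.At (𝟙_ (ObjPair C)) a := app (ε P.toFunctor) a (tstar a)

/-- The laxator `⊗_{a,b;c}`. -/
def mul (P : LaxProf E C) {d d' : ObjPair C} {a b c : E} (h : AddLE a b c) (x : P.At d a)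
    (y : P.At d' b) : P.At (d ⊗ d') c :=
  app (μ P.toFunctor d d') c (tpair h x y)

theorem reg_eps (P : LaxProf E C) {a b : E} (h : a ≤ b) :
    (P.obj (𝟙_ (ObjPair C))).reg h (P.eps a) = P.eps b := (app_reg _ h _).symm

theorem reg_mul (P : LaxProf E C) {d d' : ObjPair C} {a b c c' : E} (hc : c ≤ c') (h : AddLE a b c)
    (x : P.At d a) (y : P.At d' b) :
    (P.obj (d ⊗ d')).reg hc (P.mul h x y) = P.mul (h.mono le_rfl le_rfl hc) x y :=
  (app_reg _ hc _).symm

theorem mul_reg (P : LaxProf E C) {d d' : ObjPair C} {a b a' b' c : E} (ha : a ≤ a') (hb : b ≤ b')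
    (h : AddLE a' b' c) (x : P.At d a) (y : P.At d' b) :
    P.mul h ((P.obj d).reg ha x) ((P.obj d').reg hb y) = P.mul (h.mono ha hb le_rfl) x y :=
  congrArg (app (μ P.toFunctor d d') c) (tpair_reg ha hb h x y)

theorem mul_tr (P : LaxProf E C) {d d' k k' : ObjPair C} {a b c : E} (h : AddLE a b c) (f : d ⟶ d')
    (g : k ⟶ k') (x : P.At d a) (y : P.At k b) :
    P.mul h (P.tr f x) (P.tr g y) = P.tr (f ⊗ₘ g) (P.mul h x y) :=
  congrArg (fun t => app t c (tpair h x y)) (μ_natural P.toFunctor f g)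

theorem mul_assoc (P : LaxProf E C) {d d' d'' : ObjPair C} {a b c x y z : E} (h1 : AddLE a b x)
    (h2 : AddLE x c z) (h3 : AddLE b c y) (h4 : AddLE a y z) (p : P.At d a) (q : P.At d' b)
    (r : P.At d'' c) :
    P.tr (α_ d d' d'').hom (P.mul h2 (P.mul h1 p q) r) = P.mul h4 p (P.mul h3 q r) := by
  have := congrArg (fun t => app t z (tpair h2 (tpair h1 p q) r)) (associativity P.toFunctor d d' d'')
  simp only [app_comp, app_whiskerRight] at this
  rw [app_associator h1 h2 h3 h4, app_whiskerLeft] at this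
  exact this

theorem eps_mul (P : LaxProf E C) {d : ObjPair C} {a b c : E} (h : AddLE a b c) (p : P.At d b) :
    P.tr (λ_ d).hom (P.mul h (P.eps a) p) = (P.obj d).reg h.right_le p :=
  (congrArg (fun t => app t c (tpair h (tstar a) p)) (left_unitality P.toFunctor d)).symm

theorem mul_eps (P : LaxProf E C) {d : ObjPair C} {a b c : E} (h : AddLE a b c) (p : P.At d a) :
    P.tr (ρ_ d).hom (P.mul h p (P.eps b)) = (P.obj d).reg h.left_le p :=
  (congrArg (fun t => app t c (tpair h p (tstar b))) (right_unitality P.toFunctor d)).symm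

/-- A lax monoidal functor from its elements. -/
def mkLax (F : ObjPair C ⥤ Copresheaf E)
    (e : ∀ a, (F.obj (𝟙_ (ObjPair C))).El a)
    (m : ∀ {d d' : ObjPair C} {a b c : E}, AddLE a b c → (F.obj d).El a → (F.obj d').El b →
      (F.obj (d ⊗ d')).El c)
    (reg_e : ∀ {a b : E} (h : a ≤ b), e b = (F.obj (𝟙_ (ObjPair C))).reg h (e a))
    (reg_m : ∀ {d d' : ObjPair C} {a b c c' : E} (hc : c ≤ c') (h : AddLE a b c) (x : (F.obj d).El a)
      (y : (F.obj d').El b), m (h.mono le_rfl le_rfl hc) x y = (F.obj (d ⊗ d')).reg hc (m h x y))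
    (m_reg : ∀ {d d' : ObjPair C} {a b a' b' c : E} (ha : a ≤ a') (hb : b ≤ b') (h : AddLE a' b' c)
      (x : (F.obj d).El a) (y : (F.obj d').El b),
      m h ((F.obj d).reg ha x) ((F.obj d').reg hb y) = m (h.mono ha hb le_rfl) x y)
    (m_tr : ∀ {d d' k k' : ObjPair C} {a b c : E} (h : AddLE a b c) (f : d ⟶ d') (g : k ⟶ k')
      (x : (F.obj d).El a) (y : (F.obj k).El b),
      m h (app (F.map f) a x) (app (F.map g) b y) = app (F.map (f ⊗ₘ g)) c (m h x y))
    (m_assoc : ∀ {d d' d'' : ObjPair C} {a b c x y z : E} (h1 : AddLE a b x) (h2 : AddLE x c z)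
      (h3 : AddLE b c y) (h4 : AddLE a y z) (p : (F.obj d).El a) (q : (F.obj d').El b)
      (r : (F.obj d'').El c),
      app (F.map (α_ d d' d'').hom) z (m h2 (m h1 p q) r) = m h4 p (m h3 q r))
    (e_m : ∀ {d : ObjPair C} {a b c : E} (h : AddLE a b c) (p : (F.obj d).El b),
      app (F.map (λ_ d).hom) c (m h (e a) p) = (F.obj d).reg h.right_le p)
    (m_e : ∀ {d : ObjPair C} {a b c : E} (h : AddLE a b c) (p : (F.obj d).El a),
      app (F.map (ρ_ d).hom) c (m h p (e b)) = (F.obj d).reg h.left_le p) : LaxProf E C :=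
  { F with
    laxMonoidal :=
      { ε := homMk (fun a _ => e a) (fun h _ => reg_e h)
        μ := fun d d' => tensorDesc (fun _ _ _ h x y => m h x y)
          (fun ha hb h x y => m_reg ha hb h x y) (fun hc h x y => reg_m hc h x y)
        μ_natural_left := fun f d => tensor_hom_ext fun a b c h x y => by
          have := m_tr h f (𝟙 d) x y
          rw [CategoryTheory.Functor.map_id, app_id, tensorHom_id] at this
          exact this
        μ_natural_right := fun d f => tensor_hom_ext fun a b c h x y => by
          have := m_tr h (𝟙 d) f x y
          rw [CategoryTheory.Functor.map_id, app_id, id_tensorHom] at this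
          exact this
        associativity := fun d d' d'' => tensor_hom_ext₃ fun a b c x y z h1 h2 h3 h4 p q r => by
          simp only [app_comp, app_whiskerRight]
          rw [app_associator h1 h2 h3 h4, app_whiskerLeft]
          exact m_assoc h1 h2 h3 h4 p q r
        left_unitality := fun d => tensor_hom_ext fun a b c h x y => (e_m h y).symm
        right_unitality := fun d => tensor_hom_ext fun a b c h x y => (m_e h x).symm } }

/-- A monoidal natural transformation from its components. -/
def mkHom {P Q : LaxProf E C} (f : ∀ (d : ObjPair C) (a : E), P.At d a → Q.At d a)
    (f_reg : ∀ (d : ObjPair C) {a b : E} (h : a ≤ b) (x : P.At d a),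
      f d b ((P.obj d).reg h x) = (Q.obj d).reg h (f d a x))
    (f_tr : ∀ {d d' : ObjPair C} (g : d ⟶ d') (a : E) (x : P.At d a),
      f d' a (P.tr g x) = Q.tr g (f d a x))
    (f_eps : ∀ a : E, f _ a (P.eps a) = Q.eps a)
    (f_mul : ∀ {d d' : ObjPair C} {a b c : E} (h : AddLE a b c) (x : P.At d a) (y : P.At d' b),
      f _ c (P.mul h x y) = Q.mul h (f d a x) (f d' b y)) : P ⟶ Q where
  hom :=
    { app := fun d => homMk (f d) (f_reg d)
      naturality := fun _ _ g => hom_ext fun a x => f_tr g a x }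
  isMonoidal :=
    { unit := hom_ext fun a _ => f_eps a
      tensor := fun _ _ => tensor_hom_ext fun _ _ _ h x y => f_mul h x y }

/-- The component of a monoidal natural transformation. -/
def ap {P Q : LaxProf E C} (α : P ⟶ Q) (d : ObjPair C) (a : E) (x : P.At d a) : Q.At d a :=
  app (α.hom.app d) a x

@[simp] theorem ap_mkHom {P Q : LaxProf E C} (f) (f_reg) (f_tr) (f_eps) (f_mul) (d : ObjPair C)
    (a : E) (x : P.At d a) :
    ap (mkHom (P := P) (Q := Q) f f_reg f_tr f_eps f_mul) d a x = f d a x := rfl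

@[simp] theorem ap_id (P : LaxProf E C) (d : ObjPair C) (a : E) (x : P.At d a) :
    ap (𝟙 P) d a x = x := rfl

@[simp] theorem ap_comp {P Q R : LaxProf E C} (α : P ⟶ Q) (β : Q ⟶ R) (d : ObjPair C) (a : E)
    (x : P.At d a) : ap (α ≫ β) d a x = ap β d a (ap α d a x) := rfl

theorem hom_ext {P Q : LaxProf E C} {α β : P ⟶ Q} (h : ∀ d a x, ap α d a x = ap β d a x) :
    α = β :=
  LaxMonoidalFunctor.hom_ext (NatTrans.ext (funext fun d => Copresheaf.hom_ext fun a x => h d a x))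

theorem ap_reg {P Q : LaxProf E C} (α : P ⟶ Q) (d : ObjPair C) {a b : E} (h : a ≤ b)
    (x : P.At d a) : ap α d b ((P.obj d).reg h x) = (Q.obj d).reg h (ap α d a x) :=
  app_reg _ h x

theorem ap_tr {P Q : LaxProf E C} (α : P ⟶ Q) {d d' : ObjPair C} (g : d ⟶ d') (a : E)
    (x : P.At d a) : ap α d' a (P.tr g x) = Q.tr g (ap α d a x) :=
  congrArg (fun t => app t a x) (α.hom.naturality g)

theorem ap_eps {P Q : LaxProf E C} (α : P ⟶ Q) (a : E) : ap α _ a (P.eps a) = Q.eps a :=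
  congrArg (fun t => app t a (tstar a)) (NatTrans.IsMonoidal.unit (τ := α.hom))

theorem ap_mul {P Q : LaxProf E C} (α : P ⟶ Q) {d d' : ObjPair C} {a b c : E} (h : AddLE a b c)
    (x : P.At d a) (y : P.At d' b) :
    ap α _ c (P.mul h x y) = Q.mul h (ap α d a x) (ap α d' b y) :=
  congrArg (fun t => app t c (tpair h x y)) (NatTrans.IsMonoidal.tensor (τ := α.hom) d d')

/-- An element of `∐_Y Q(X; Y)(a) × P(Y; Z)(a)`. -/
structure CompEl (P Q : LaxProf E C) (d : ObjPair C) (a : E) : Type u where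
  mid : C
  fst : Q.At (d.1, ⟨mid⟩) a
  snd : P.At (op ⟨mid⟩, d.2) a

theorem CompEl.ext' {P Q : LaxProf E C} {d : ObjPair C} {a : E} {s t : CompEl P Q d a}
    (f : (⟨s.mid⟩ : Discrete C) ⟶ ⟨t.mid⟩)
    (h1 : Q.tr ((𝟙 d.1, f) : (d.1, (⟨s.mid⟩ : Discrete C)) ⟶ (d.1, ⟨t.mid⟩)) s.fst = t.fst)
    (h2 : s.snd = P.tr ((f.op, 𝟙 d.2) : (op (⟨t.mid⟩ : Discrete C), d.2) ⟶ (op ⟨s.mid⟩, d.2)) t.snd) :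
    s = t := by
  obtain ⟨y, q, p⟩ := s
  obtain ⟨y', q', p'⟩ := t
  obtain rfl : y = y' := Discrete.eq_of_hom f
  simp only [tr_self] at h1 h2
  rw [h1, h2]

/-- The functor underlying `P ∘ Q`, namely `(X, Z) ↦ ∐_Y Q(X; Y) × P(Y; Z)`. -/
def compFunctor (P Q : LaxProf E C) : ObjPair C ⥤ Copresheaf E where
  obj d := Copresheaf.mk (CompEl P Q d)
    (fun h t => ⟨t.mid, (Q.obj _).reg h t.fst, (P.obj _).reg h t.snd⟩)
    (fun _ t => by simp)
    (fun _ _ t => by simp)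
  map {d d'} f := Copresheaf.homMk
    (fun a (t : CompEl P Q d a) => (⟨t.mid,
      Q.tr ((f.1, 𝟙 _) : (d.1, (⟨t.mid⟩ : Discrete C)) ⟶ (d'.1, ⟨t.mid⟩)) t.fst,
      P.tr ((𝟙 _, f.2) : (op (⟨t.mid⟩ : Discrete C), d.2) ⟶ (op ⟨t.mid⟩, d'.2)) t.snd⟩ :
      CompEl P Q d' a))
    (fun {a b} h (t : CompEl P Q d a) => congrArg₂ (CompEl.mk (d := d') (a := b) t.mid)
      (reg_tr Q _ h t.fst).symm (reg_tr P _ h t.snd).symm)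
  map_id d := Copresheaf.hom_ext fun a (t : CompEl P Q d a) =>
    congrArg₂ (CompEl.mk (d := d) (a := a) t.mid) (tr_self Q _ t.fst) (tr_self P _ t.snd)
  map_comp {d d' d''} f g := Copresheaf.hom_ext fun a (t : CompEl P Q d a) =>
    (congrArg₂ (CompEl.mk (d := d'') (a := a) t.mid)
      ((tr_tr Q _ _ t.fst).trans (congrArg (Q.tr · t.fst) (Subsingleton.elim _ _)))
      ((tr_tr P _ _ t.snd).trans (congrArg (P.tr · t.snd) (Subsingleton.elim _ _)))).symm

/-- The composite `P ∘ Q` of lax monoidal functors. -/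
def compLax (P Q : LaxProf E C) : LaxProf E C :=
  mkLax (compFunctor P Q)
    (fun a => (⟨1, Q.eps a, P.eps a⟩ : CompEl P Q (𝟙_ (ObjPair C)) a))
    (fun {d d' a b c} h (s : CompEl P Q d a) (t : CompEl P Q d' b) =>
      (⟨s.mid * t.mid, Q.mul h s.fst t.fst, P.mul h s.snd t.snd⟩ : CompEl P Q (d ⊗ d') c))
    (fun {a b} h => congrArg₂ (CompEl.mk (d := 𝟙_ (ObjPair C)) (a := b) 1)
      (reg_eps Q h).symm (reg_eps P h).symm)
    (fun {d d' a b c c'} hc h (s : CompEl P Q d a) (t : CompEl P Q d' b) =>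
      congrArg₂ (CompEl.mk (d := d ⊗ d') (a := c') (s.mid * t.mid))
      (reg_mul Q hc h _ _).symm (reg_mul P hc h _ _).symm)
    (fun {d d' a b a' b' c} ha hb h (s : CompEl P Q d a) (t : CompEl P Q d' b) =>
      congrArg₂ (CompEl.mk (d := d ⊗ d') (a := c) (s.mid * t.mid))
      (mul_reg Q ha hb h _ _) (mul_reg P ha hb h _ _))
    (fun {d d' k k' a b c} h f g (s : CompEl P Q d a) (t : CompEl P Q k b) =>
      congrArg₂ (CompEl.mk (d := d' ⊗ k') (a := c) (s.mid * t.mid))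
      ((mul_tr Q h _ _ s.fst t.fst).trans (congrArg (Q.tr · _) (Subsingleton.elim _ _)))
      ((mul_tr P h _ _ s.snd t.snd).trans (congrArg (P.tr · _) (Subsingleton.elim _ _))))
    (fun {d d' d'' a b c x y z} h1 h2 h3 h4 (p : CompEl P Q d a) (q : CompEl P Q d' b)
        (r : CompEl P Q d'' c) =>
      CompEl.ext' (Discrete.eqToHom (_root_.mul_assoc p.mid q.mid r.mid))
        ((tr_tr Q _ _ _).trans (((congrArg (Q.tr · _) (Subsingleton.elim _ _))).trans
          (mul_assoc Q h1 h2 h3 h4 p.fst q.fst r.fst)))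
        (by
          refine Eq.trans ?_ (congrArg (P.tr _) (mul_assoc P h1 h2 h3 h4 p.snd q.snd r.snd))
          exact (congrArg (P.tr · _) (Subsingleton.elim _ _)).trans (tr_tr P _ _ _).symm))
    (fun {d a b c} h (p : CompEl P Q d b) =>
      CompEl.ext' (Discrete.eqToHom (_root_.one_mul p.mid))
        ((tr_tr Q _ _ _).trans (((congrArg (Q.tr · _) (Subsingleton.elim _ _))).trans
          (eps_mul Q h p.fst)))
        (by
          refine Eq.trans ?_ (congrArg (P.tr _) (eps_mul P h p.snd))
          exact (congrArg (P.tr · _) (Subsingleton.elim _ _)).trans (tr_tr P _ _ _).symm))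
    (fun {d a b c} h (p : CompEl P Q d a) =>
      CompEl.ext' (Discrete.eqToHom (_root_.mul_one p.mid))
        ((tr_tr Q _ _ _).trans (((congrArg (Q.tr · _) (Subsingleton.elim _ _))).trans
          (mul_eps Q h p.fst)))
        (by
          refine Eq.trans ?_ (congrArg (P.tr _) (mul_eps P h p.snd))
          exact (congrArg (P.tr · _) (Subsingleton.elim _ _)).trans (tr_tr P _ _ _).symm))

/-- The functor underlying `L`: `L(X; Y)` is constant at a singleton if `X = Y`, and constant at the
empty set otherwise. -/
def unitFunctor (E : Type u) [PartialCommMonoid E] (C : Type u) [Monoid C] :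
    ObjPair C ⥤ Copresheaf E where
  obj d := Copresheaf.mk (fun _ => ULift.{u} (PLift (d.1.unop.as = d.2.as))) (fun _ t => t)
    (fun _ _ => rfl) (fun _ _ _ => rfl)
  map {d d'} f := Copresheaf.homMk
    (fun _ (t : ULift.{u} (PLift (d.1.unop.as = d.2.as))) =>
      (⟨⟨(Discrete.eq_of_hom f.1.unop).trans (t.down.down.trans (Discrete.eq_of_hom f.2))⟩⟩ :
        ULift.{u} (PLift (d'.1.unop.as = d'.2.as))))
    (fun _ _ => rfl)
  map_id _ := Copresheaf.hom_ext fun _ _ => rfl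
  map_comp _ _ := Copresheaf.hom_ext fun _ _ => rfl

/-- The unit `L` for composition. -/
def unitLax (E : Type u) [PartialCommMonoid E] (C : Type u) [Monoid C] : LaxProf E C :=
  mkLax (unitFunctor E C)
    (fun _ => (⟨⟨rfl⟩⟩ : ULift.{u} (PLift ((1 : C) = 1))))
    (fun {d d' _ _ _} _ (s : ULift.{u} (PLift (d.1.unop.as = d.2.as)))
        (t : ULift.{u} (PLift (d'.1.unop.as = d'.2.as))) =>
      (⟨⟨congrArg₂ (· * ·) s.down.down t.down.down⟩⟩ :
        ULift.{u} (PLift (d.1.unop.as * d'.1.unop.as = d.2.as * d'.2.as))))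
    (fun _ => rfl) (fun _ _ _ _ => rfl) (fun _ _ _ _ _ => rfl) (fun _ _ _ _ _ => rfl)
    (fun _ _ _ _ _ _ _ => rfl) (fun _ _ => rfl) (fun _ _ => rfl)

/-- An element of `P ∘ Q`. -/
def cmk {P Q : LaxProf E C} {d : ObjPair C} {a : E} (Y : C) (q : Q.At (d.1, ⟨Y⟩) a)
    (p : P.At (op ⟨Y⟩, d.2) a) : (compLax P Q).At d a := CompEl.mk (d := d) (a := a) Y q p

/-- The element of `L(X; X)`, at a grade. -/
def unitEl (X : C) (a : E) : (unitLax E C).At (op ⟨X⟩, ⟨X⟩) a :=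
  (⟨⟨rfl⟩⟩ : ULift.{u} (PLift (X = X)))

/-- Composition of lax monoidal functors, on morphisms. -/
def compMap {P Q P' Q' : LaxProf E C} (α : P ⟶ P') (β : Q ⟶ Q') : compLax P Q ⟶ compLax P' Q' :=
  mkHom (fun d a (t : CompEl P Q d a) =>
      (⟨t.mid, ap β _ a t.fst, ap α _ a t.snd⟩ : CompEl P' Q' d a))
    (fun d a b h (t : CompEl P Q d a) => congrArg₂ (CompEl.mk (d := d) (a := b) t.mid)
      (ap_reg β _ h _) (ap_reg α _ h _))
    (fun {d d'} g a (t : CompEl P Q d a) => congrArg₂ (CompEl.mk (d := d') (a := a) t.mid)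
      (ap_tr β _ _ _) (ap_tr α _ _ _))
    (fun a => congrArg₂ (CompEl.mk (d := 𝟙_ (ObjPair C)) (a := a) 1) (ap_eps β a) (ap_eps α a))
    (fun {d d' a b c} h (s : CompEl P Q d a) (t : CompEl P Q d' b) =>
      congrArg₂ (CompEl.mk (d := d ⊗ d') (a := c) (s.mid * t.mid)) (ap_mul β h s.fst t.fst) (ap_mul α h s.snd t.snd))

/-- The associator of composition. -/
def compAssoc (P Q R : LaxProf E C) : compLax (compLax P Q) R ≅ compLax P (compLax Q R) where
  hom := mkHom (fun d a (t : CompEl (compLax P Q) R d a) =>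
      let s : CompEl P Q (op ⟨t.mid⟩, d.2) a := t.snd
      (⟨s.mid, (⟨t.mid, t.fst, s.fst⟩ : CompEl Q R (d.1, ⟨s.mid⟩) a), s.snd⟩ :
        CompEl P (compLax Q R) d a))
    (fun _ _ _ _ _ => rfl)
    (fun {d d'} g a (t : CompEl (compLax P Q) R d a) => by
      let s : CompEl P Q (op ⟨t.mid⟩, d.2) a := t.snd
      refine congrArg₂ (CompEl.mk (P := P) (Q := compLax Q R) (d := d') (a := a) s.mid)
        (congrArg₂ (CompEl.mk (P := Q) (Q := R) (d := (d'.1, ⟨s.mid⟩)) (a := a) t.mid) rfl ?_) rfl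
      exact (tr_self Q _ s.fst).trans (tr_self Q _ s.fst).symm)
    (fun _ => rfl)
    (fun _ _ _ => rfl)
  inv := mkHom (fun d a (t : CompEl P (compLax Q R) d a) =>
      let s : CompEl Q R (d.1, ⟨t.mid⟩) a := t.fst
      (⟨s.mid, s.fst, (⟨t.mid, s.snd, t.snd⟩ : CompEl P Q (op ⟨s.mid⟩, d.2) a)⟩ :
        CompEl (compLax P Q) R d a))
    (fun _ _ _ _ _ => rfl)
    (fun {d d'} g a (t : CompEl P (compLax Q R) d a) => by
      let s : CompEl Q R (d.1, ⟨t.mid⟩) a := t.fst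
      refine congrArg₂ (CompEl.mk (P := compLax P Q) (Q := R) (d := d') (a := a) s.mid) rfl
        (congrArg₂ (CompEl.mk (P := P) (Q := Q) (d := (op ⟨s.mid⟩, d'.2)) (a := a) t.mid) ?_ rfl)
      exact (tr_self Q _ s.snd).trans (tr_self Q _ s.snd).symm)
    (fun _ => rfl)
    (fun _ _ _ => rfl)
  hom_inv_id := hom_ext fun _ _ _ => rfl
  inv_hom_id := hom_ext fun _ _ _ => rfl

/-- The morphism of `Discrete C` given by an element of `L(X; Y)`. -/
def unitHom {d : ObjPair C} {a : E} (t : (unitLax E C).At d a) : d.1.unop ⟶ d.2 :=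
  Discrete.eqToHom (ULift.down (α := PLift (d.1.unop.as = d.2.as)) t).down

/-- The left unitor of composition. -/
def compLeftUnitor (P : LaxProf E C) : compLax (unitLax E C) P ≅ P where
  hom := mkHom (fun d a (t : CompEl (unitLax E C) P d a) =>
      P.tr ((𝟙 d.1, unitHom t.snd) : (d.1, (⟨t.mid⟩ : Discrete C)) ⟶ (d.1, d.2)) t.fst)
    (fun d a b h (t : CompEl (unitLax E C) P d a) => (reg_tr P _ h t.fst).symm)
    (fun {d d'} g a (t : CompEl (unitLax E C) P d a) =>
      (tr_tr P _ _ _).trans ((congrArg (P.tr · _) (Subsingleton.elim _ _)).trans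
        (tr_tr P _ _ _).symm))
    (fun a => tr_self P _ _)
    (fun {d d' a b c} h (s : CompEl (unitLax E C) P d a) (t : CompEl (unitLax E C) P d' b) =>
      (congrArg (P.tr · _) (Subsingleton.elim _ _)).trans (mul_tr P h _ _ s.fst t.fst).symm)
  inv := mkHom (fun d a p =>
      (⟨d.2.as, p, (⟨⟨rfl⟩⟩ : ULift.{u} (PLift (d.2.as = d.2.as)))⟩ : CompEl (unitLax E C) P d a))
    (fun _ _ _ _ _ => rfl)
    (fun {d d'} g a p => (CompEl.ext' g.2
      ((tr_tr P _ _ _).trans (congrArg (P.tr · p) (Subsingleton.elim _ _))) rfl).symm)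
    (fun _ => rfl)
    (fun _ _ _ => rfl)
  hom_inv_id := hom_ext fun d a (t : CompEl (unitLax E C) P d a) =>
    (CompEl.ext' (unitHom t.snd) rfl rfl).symm
  inv_hom_id := hom_ext fun d a p => tr_self P _ p

/-- The right unitor of composition. -/
def compRightUnitor (P : LaxProf E C) : compLax P (unitLax E C) ≅ P where
  hom := mkHom (fun d a (t : CompEl P (unitLax E C) d a) =>
      P.tr (((unitHom t.fst).op, 𝟙 d.2) : (op (⟨t.mid⟩ : Discrete C), d.2) ⟶ (d.1, d.2)) t.snd)
    (fun d a b h (t : CompEl P (unitLax E C) d a) => (reg_tr P _ h t.snd).symm)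
    (fun {d d'} g a (t : CompEl P (unitLax E C) d a) =>
      (tr_tr P _ _ _).trans ((congrArg (P.tr · _) (Subsingleton.elim _ _)).trans
        (tr_tr P _ _ _).symm))
    (fun a => tr_self P _ _)
    (fun {d d' a b c} h (s : CompEl P (unitLax E C) d a) (t : CompEl P (unitLax E C) d' b) =>
      (congrArg (P.tr · _) (Subsingleton.elim _ _)).trans (mul_tr P h _ _ s.snd t.snd).symm)
  inv := mkHom (fun d a p =>
      (⟨d.1.unop.as, (⟨⟨rfl⟩⟩ : ULift.{u} (PLift (d.1.unop.as = d.1.unop.as))), p⟩ :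
        CompEl P (unitLax E C) d a))
    (fun _ _ _ _ _ => rfl)
    (fun {d d'} g a p => CompEl.ext' g.1.unop rfl
      ((congrArg (P.tr · p) (Subsingleton.elim _ _)).trans (tr_tr P _ _ _).symm))
    (fun _ => rfl)
    (fun _ _ _ => rfl)
  hom_inv_id := hom_ext fun d a (t : CompEl P (unitLax E C) d a) =>
    CompEl.ext' (unitHom t.fst) rfl rfl
  inv_hom_id := hom_ext fun d a p => tr_self P _ p

/-- The monoidal structure `(∘, L)` on lax monoidal functors. -/
instance compMonoidal : MonoidalCategory (LaxProf E C) where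
  tensorObj := compLax
  tensorHom := compMap
  whiskerLeft P _ _ α := compMap (𝟙 P) α
  whiskerRight α Q := compMap α (𝟙 Q)
  tensorUnit := unitLax E C
  associator := compAssoc
  leftUnitor := compLeftUnitor
  rightUnitor := compRightUnitor
  tensorHom_def _ _ := hom_ext fun _ _ _ => rfl
  id_tensorHom_id _ _ := hom_ext fun _ _ _ => rfl
  tensorHom_comp_tensorHom _ _ _ _ := hom_ext fun _ _ _ => rfl
  whiskerLeft_id _ _ := hom_ext fun _ _ _ => rfl
  id_whiskerRight _ _ := hom_ext fun _ _ _ => rfl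
  associator_naturality _ _ _ := hom_ext fun _ _ _ => rfl
  leftUnitor_naturality {P _} α := hom_ext fun d a (t : CompEl (unitLax E C) P d a) =>
    (ap_tr α ((𝟙 d.1, unitHom t.snd) : (d.1, (⟨t.mid⟩ : Discrete C)) ⟶ (d.1, d.2)) a t.fst).symm
  rightUnitor_naturality {P _} α := hom_ext fun d a (t : CompEl P (unitLax E C) d a) =>
    (ap_tr α (((unitHom t.fst).op, 𝟙 d.2) : (op (⟨t.mid⟩ : Discrete C), d.2) ⟶ (d.1, d.2))
      a t.snd).symm
  pentagon P Q R S := hom_ext fun d a (t : CompEl (compLax (compLax P Q) R) S d a) => rfl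
  triangle P Q := hom_ext fun d a (t : CompEl (compLax P (unitLax E C)) Q d a) => by
    let s : CompEl P (unitLax E C) (op ⟨t.mid⟩, d.2) a := t.snd
    exact (CompEl.ext' (unitHom s.fst) rfl rfl).symm

end

end LaxProf
/-! ### Monoidal categories graded by a partial commutative monoid -/

/-- The data of a monoidal category graded by `E`, with monoid of objects `C`. The monoidal product
`⊗_{a,b}` is indexed by a proof that `a ⊕ b` is defined with value `c`. -/
structure GradedData (E : Type u) [PartialCommMonoid E] (C : Type u) [Monoid C] where
  /-- the set of morphisms `ℂ_a(X; Y)` -/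
  Hom : E → C → C → Type u
  /-- identities at each grade -/
  id (a : E) (X : C) : Hom a X X
  /-- composition at each grade -/
  comp {a : E} {X Y Z : C} : Hom a X Y → Hom a Y Z → Hom a X Z
  /-- regrading -/
  reg {a b : E} (h : a ≤ b) {X Y : C} : Hom a X Y → Hom b X Y
  /-- monoidal products of morphisms of orthogonal grades -/
  tens {a b c : E} (h : c ∈ add a b) {X Y X' Y' : C} :
    Hom a X Y → Hom b X' Y' → Hom c (X * X') (Y * Y')

/-- An `E`-graded monoidal category with monoid of objects `C`. Equations between morphisms whose
endpoints agree only by the monoid laws of `C` are heterogeneous. -/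
structure GradedMonoidalCategory (E : Type u) [PartialCommMonoid E] (C : Type u) [Monoid C] extends
    GradedData E C where
  id_comp {a : E} {X Y : C} (f : Hom a X Y) : comp (id a X) f = f
  comp_id {a : E} {X Y : C} (f : Hom a X Y) : comp f (id a Y) = f
  comp_assoc {a : E} {X Y Z W : C} (f : Hom a X Y) (g : Hom a Y Z) (k : Hom a Z W) :
    comp (comp f g) k = comp f (comp g k)
  reg_id {a b : E} (h : a ≤ b) (X : C) : reg h (id a X) = id b X
  reg_comp {a b : E} (h : a ≤ b) {X Y Z : C} (f : Hom a X Y) (g : Hom a Y Z) :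
    reg h (comp f g) = comp (reg h f) (reg h g)
  reg_self {a : E} {X Y : C} (f : Hom a X Y) : reg (le_refl a) f = f
  reg_reg {a b c : E} (h : a ≤ b) (h' : b ≤ c) {X Y : C} (f : Hom a X Y) :
    reg h' (reg h f) = reg (h.trans h') f
  reg_tens {a b s c d t : E} (hs : s ∈ add a b) (ht : t ∈ add c d) (hac : a ≤ c) (hbd : b ≤ d)
    (hst : s ≤ t) {X Y X' Y' : C} (f : Hom a X Y) (g : Hom b X' Y') :
    reg hst (tens hs f g) = tens ht (reg hac f) (reg hbd g)
  tens_unit {a : E} {X Y : C} (f : Hom a X Y) :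
    HEq (tens (mem_zero a) f (id zero 1)) f
  unit_tens {a : E} {X Y : C} (f : Hom a X Y) :
    HEq (tens (zero_mem a) (id zero 1) f) f
  tens_assoc {a b c x y z : E} (h1 : x ∈ add a b) (h2 : z ∈ add x c) (h3 : y ∈ add b c)
    (h4 : z ∈ add a y) {X Y X' Y' X'' Y'' : C} (f : Hom a X Y) (g : Hom b X' Y')
    (k : Hom c X'' Y'') :
    HEq (tens h2 (tens h1 f g) k) (tens h4 f (tens h3 g k))
  id_tens (X Y : C) : tens (mem_zero zero) (id zero X) (id zero Y) = id zero (X * Y)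
  interchange {a b c : E} (h : c ∈ add a b) {X Y Z X' Y' Z' : C} (f : Hom a X Y)
    (g : Hom b X' Y') (k : Hom a Y Z) (l : Hom b Y' Z') :
    comp (tens h f g) (tens h k l) = tens h (comp f k) (comp g l)

section Underlying

variable {E : Type u} [PartialCommMonoid E] {C : Type u} [Monoid C]

open Copresheaf

/-- The graded data underlying a monoid in `(LaxProf E C, ∘, L)`: the elements of its lax monoidal
functor with their action of the grades, the components of its multiplication and unit, and the
components `⊗_{a,b;a⊕b}` of its laxator. -/
noncomputable def monoidData (M : Mon (LaxProf E C)) : GradedData E C where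
  Hom a X Y := M.X.At (op ⟨X⟩, ⟨Y⟩) a
  id a X := LaxProf.ap (MonObj.one (X := M.X)) (op ⟨X⟩, ⟨X⟩) a (LaxProf.unitEl X a)
  comp {a X Y Z} f g :=
    LaxProf.ap (MonObj.mul (X := M.X)) (op ⟨X⟩, ⟨Z⟩) a (LaxProf.cmk (d := (op ⟨X⟩, ⟨Z⟩)) Y f g)
  reg {a b} h {X Y} f := (M.X.obj (op ⟨X⟩, ⟨Y⟩)).reg h f
  tens {a b c} h {X Y X' Y'} f g :=
    LaxProf.mul M.X (d := (op ⟨X⟩, ⟨Y⟩)) (d' := (op ⟨X'⟩, ⟨Y'⟩)) (addLE_of_mem h) f g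

/-- The graded data underlying a Freyd category over the discrete monoidal category `C`, enriched in
the duoidal category of copresheaves. -/
noncomputable def freydData (F : FreydCategory (Copresheaf E) (Discrete C)) : GradedData E C where
  Hom a X Y := (F.hom.obj (op ⟨X⟩, ⟨Y⟩)).El a
  id a X := app (F.ident ⟨X⟩) a (pt a)
  comp {a X Y Z} f g := app (F.comp ⟨X⟩ ⟨Y⟩ ⟨Z⟩) a (prodMk f g)
  reg {a b} h {X Y} f := (F.hom.obj (op ⟨X⟩, ⟨Y⟩)).reg h f
  tens {a b c} h {X Y X' Y'} f g :=
    app (Functor.LaxMonoidal.μ F.hom.toFunctor (op ⟨X⟩, ⟨Y⟩) (op ⟨X'⟩, ⟨Y'⟩)) c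
      (tpair (addLE_of_mem h) f g)

end Underlying

end PCMGraded

/-!
Both a monoid for `(∘, L)` and a duoidally enriched Freyd category are a lax monoidal functor `P`
with identities and compositions on its elements that commute with the action of the grades and with
the laxator. The structure `SeqStructure P` records this common content. Passing to elements is
lossless in both cases: a map out of `P ∘ P` is a family of functions on pairs of elements, since
`P ∘ P` is a coproduct of pointwise products, and the naturality conditions in the objects are void,
since the only morphisms of a discrete category are identities. This gives `monEquiv` and
`freydEquiv`.

It remains to identify the pairs `(P, S : SeqStructure P)` with graded monoidal categories
(`gradedEquiv`). A map out of a convolution `F ∗ G` is a family of functions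
`F(a) × G(b) → H(c)` for `a ⊕ b ≤ c`, natural in `a`, `b` and `c`. By naturality in `c`, such a family
is determined by its members with `c = a ⊕ b`, and conversely products `⊗_{a,b}` extend to
`a ⊕ b ≤ c` by regrading (`GradedMonoidalCategory.tensLE`). So the laxator of `P` amounts to the
products `⊗_{a,b}`, and its coherence to their unit and associativity laws. The lax unit carries no
data: it is the identity of the unit object, because the unit of a monoid is a monoidal
transformation, and by an axiom of Freyd categories. A graded monoidal category is only required to
satisfy the laws for identities and products at grade `0`, but they hold at all grades, because all
identities are regradings of those of grade `0`.

That the two constructions are mutually inverse is an equality of functors. It holds because the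
comparison map is the identity at each object (`SeqStructure.comparison`), and a monoidal
transformation whose components are identities forces its source and target to be equal
(`laxMonoidalFunctor_eq_of_hom`).
-/

namespace PCMGraded

open PartialCommMonoid Copresheaf

variable {E : Type u} [PartialCommMonoid E] {C : Type u} [Monoid C]

/-! ### Sequential structures on lax monoidal functors -/

/-- Any two objects of `C_objᵒᵖ × C_obj` joined by a morphism are equal. -/
theorem ObjPair.eq_of_hom {C : Type u} {d d' : ObjPair C} (f : d ⟶ d') : d = d' := by
  obtain ⟨⟨⟨X⟩⟩, ⟨Y⟩⟩ := d
  obtain ⟨⟨⟨X'⟩⟩, ⟨Y'⟩⟩ := d'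
  obtain rfl : X' = X := Discrete.eq_of_hom f.1.unop
  obtain rfl : Y = Y' := Discrete.eq_of_hom f.2
  rfl

/-- Sequential identities and composition on a lax monoidal functor, given on elements: at each
grade they form a category, they are compatible with regrading, the lax unit is the identity of the
unit object, and the laxator preserves identities and composition. Composition is in diagrammatic
order. -/
@[ext]
structure SeqStructure (P : LaxProf E C) where
  id (a : E) (X : C) : P.At (op ⟨X⟩, ⟨X⟩) a
  comp {a : E} {X Y Z : C} : P.At (op ⟨X⟩, ⟨Y⟩) a → P.At (op ⟨Y⟩, ⟨Z⟩) a → P.At (op ⟨X⟩, ⟨Z⟩) a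
  reg_id {a b : E} (h : a ≤ b) (X : C) : (P.obj _).reg h (id a X) = id b X
  reg_comp {a b : E} (h : a ≤ b) {X Y Z : C} (f : P.At (op ⟨X⟩, ⟨Y⟩) a)
    (g : P.At (op ⟨Y⟩, ⟨Z⟩) a) :
    (P.obj _).reg h (comp f g) = comp ((P.obj _).reg h f) ((P.obj _).reg h g)
  id_comp {a : E} {X Y : C} (f : P.At (op ⟨X⟩, ⟨Y⟩) a) : comp (id a X) f = f
  comp_id {a : E} {X Y : C} (f : P.At (op ⟨X⟩, ⟨Y⟩) a) : comp f (id a Y) = f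
  comp_assoc {a : E} {X Y Z W : C} (f : P.At (op ⟨X⟩, ⟨Y⟩) a) (g : P.At (op ⟨Y⟩, ⟨Z⟩) a)
    (k : P.At (op ⟨Z⟩, ⟨W⟩) a) : comp (comp f g) k = comp f (comp g k)
  id_one (a : E) : id a 1 = P.eps a
  mul_id {a b c : E} (h : AddLE a b c) (X Y : C) :
    P.mul h (id a X) (id b Y) = id c (X * Y)
  mul_comp {a b c : E} (h : AddLE a b c) {X Y Z X' Y' Z' : C}
    (f : P.At (op ⟨X⟩, ⟨Y⟩) a) (g : P.At (op ⟨Y⟩, ⟨Z⟩) a)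
    (k : P.At (op ⟨X'⟩, ⟨Y'⟩) b) (l : P.At (op ⟨Y'⟩, ⟨Z'⟩) b) :
    P.mul h (comp f g) (comp k l) =
      comp (X := X * X') (Y := Y * Y') (Z := Z * Z') (P.mul h f k) (P.mul h g l)

namespace LaxProf

/-- Transport along a morphism of a discrete category does nothing. -/
theorem tr_heq (P : LaxProf E C) {d d' : ObjPair C} (f : d ⟶ d') {a : E} (x : P.At d a) :
    HEq (P.tr f x) x := by
  obtain rfl := ObjPair.eq_of_hom f
  rw [tr_self]

end LaxProf

namespace SeqStructure

variable {P : LaxProf E C}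

/-- The graded data of a lax monoidal functor with a sequential structure; `⊗_{a,b}` is the
component of the laxator at `a`, `b` and `a ⊕ b`. -/
noncomputable def data (S : SeqStructure P) : GradedData E C where
  Hom a X Y := P.At (op ⟨X⟩, ⟨Y⟩) a
  id := S.id
  comp := S.comp
  reg h _ _ f := (P.obj _).reg h f
  tens h _ _ _ _ f g := P.mul (addLE_of_mem h) f g

/-- The graded monoidal category of a lax monoidal functor with a sequential structure. -/
noncomputable def graded (S : SeqStructure P) : GradedMonoidalCategory E C where
  toGradedData := S.data
  id_comp := S.id_comp
  comp_id := S.comp_id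
  comp_assoc := S.comp_assoc
  reg_id := S.reg_id
  reg_comp h _ _ _ f g := S.reg_comp h f g
  reg_self f := Copresheaf.reg_self _ _ f
  reg_reg h h' _ _ f := Copresheaf.reg_reg _ h h' f
  reg_tens hs ht hac hbd hst _ _ _ _ f g := by
    exact (P.reg_mul hst _ f g).trans (P.mul_reg hac hbd (addLE_of_mem ht) f g).symm
  tens_unit {a X Y} f := by
    have h := (P.mul_eps (d := (op ⟨X⟩, ⟨Y⟩)) (addLE_of_mem (mem_zero a)) f).trans
      (Copresheaf.reg_self _ _ _)
    rw [← S.id_one] at h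
    exact (P.tr_heq _ _).symm.trans (heq_of_eq h)
  unit_tens {a X Y} f := by
    have h := (P.eps_mul (d := (op ⟨X⟩, ⟨Y⟩)) (addLE_of_mem (zero_mem a)) f).trans
      (Copresheaf.reg_self _ _ _)
    rw [← S.id_one] at h
    exact (P.tr_heq _ _).symm.trans (heq_of_eq h)
  tens_assoc {a b c x y z} h1 h2 h3 h4 {X Y X' Y' X'' Y''} f g k :=
    (P.tr_heq _ _).symm.trans (heq_of_eq (P.mul_assoc (d := (op ⟨X⟩, ⟨Y⟩)) (d' := (op ⟨X'⟩, ⟨Y'⟩))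
      (d'' := (op ⟨X''⟩, ⟨Y''⟩)) (addLE_of_mem h1) (addLE_of_mem h2) (addLE_of_mem h3)
      (addLE_of_mem h4) f g k))
  id_tens := S.mul_id _
  interchange h _ _ _ _ _ _ f g k l := (S.mul_comp (addLE_of_mem h) f k g l).symm

end SeqStructure

/-! ### Monoids for composition -/

/-- The sequential structure of a monoid for `(∘, L)`: its unit and multiplication on elements. The
first factor of `P ∘ P` is the later one in diagrammatic order, so the right unit law of the monoid
is the left identity law of composition. -/
noncomputable def SeqStructure.ofMonObj (P : LaxProf E C) [MonObj P] : SeqStructure P where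
  id a X := LaxProf.ap (MonObj.one (X := P)) (op ⟨X⟩, ⟨X⟩) a (LaxProf.unitEl X a)
  comp {a X Y Z} f g :=
    LaxProf.ap (MonObj.mul (X := P)) (op ⟨X⟩, ⟨Z⟩) a (LaxProf.cmk (d := (op ⟨X⟩, ⟨Z⟩)) Y f g)
  reg_id h X := (LaxProf.ap_reg _ _ h _).symm
  reg_comp h X Y Z f g := (LaxProf.ap_reg _ _ h _).symm
  id_comp {a X Y} f :=
    (congrArg (fun t => LaxProf.ap t (op ⟨X⟩, ⟨Y⟩) a
      (LaxProf.cmk (d := (op ⟨X⟩, ⟨Y⟩)) X (LaxProf.unitEl X a) f)) (MonObj.mul_one P)).trans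
      (P.tr_self _ f)
  comp_id {a X Y} f :=
    (congrArg (fun t => LaxProf.ap t (op ⟨X⟩, ⟨Y⟩) a
      (LaxProf.cmk (d := (op ⟨X⟩, ⟨Y⟩)) Y f (LaxProf.unitEl Y a))) (MonObj.one_mul P)).trans
      (P.tr_self _ f)
  comp_assoc {a X Y Z W} f g k :=
    (congrArg (fun t => LaxProf.ap t (op ⟨X⟩, ⟨W⟩) a
      (LaxProf.cmk (d := (op ⟨X⟩, ⟨W⟩)) Y f (LaxProf.cmk (d := (op ⟨Y⟩, ⟨W⟩)) Z g k)))
      (MonObj.mul_assoc P)).symm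
  id_one a := LaxProf.ap_eps (MonObj.one (X := P)) a
  mul_id h X Y := (LaxProf.ap_mul (MonObj.one (X := P)) h _ _).symm
  mul_comp h X Y Z X' Y' Z' f g k l := (LaxProf.ap_mul (MonObj.mul (X := P)) h _ _).symm

theorem exists_eq_of_unitLax_at {d : ObjPair C} {a : E} (t : (LaxProf.unitLax E C).At d a) :
    ∃ X : C, d = (op ⟨X⟩, ⟨X⟩) := by
  obtain ⟨⟨⟨X⟩⟩, ⟨Y⟩⟩ := d
  obtain ⟨⟨rfl : X = Y⟩⟩ : ULift.{u} (PLift (X = Y)) := t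
  exact ⟨X, rfl⟩

/-- The unit `L ⟶ P` given by the identities. An element of `L(X; Y)` is a proof of `X = Y`, along
which the identity of `X` is transported. -/
noncomputable def SeqStructure.unitHom {P : LaxProf E C} (S : SeqStructure P) :
    LaxProf.unitLax E C ⟶ P :=
  LaxProf.mkHom
    (fun d a t => P.tr ((𝟙 d.1, LaxProf.unitHom t) : (d.1, d.1.unop) ⟶ (d.1, d.2))
      (S.id a d.1.unop.as))
    (fun d a b h t => ((P.reg_tr _ h _).trans (congrArg (P.tr _) (S.reg_id h _))).symm)
    (fun {d d'} g a t => by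
      obtain rfl := ObjPair.eq_of_hom g
      rw [LaxProf.tr_self, LaxProf.tr_self])
    (fun a => (P.tr_self _ _).trans (S.id_one a))
    (fun {d d' a b c} h s t => by
      obtain ⟨X, rfl⟩ := exists_eq_of_unitLax_at s
      obtain ⟨Y, rfl⟩ := exists_eq_of_unitLax_at t
      exact (P.tr_self _ _).trans ((congrArg₂ (P.mul h) (P.tr_self _ _) (P.tr_self _ _)).trans
        (S.mul_id h X Y)).symm)

/-- The multiplication `P ∘ P ⟶ P` given by composition. -/
noncomputable def SeqStructure.mulHom {P : LaxProf E C} (S : SeqStructure P) :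
    LaxProf.compLax P P ⟶ P :=
  LaxProf.mkHom
    (fun d a (t : LaxProf.CompEl P P d a) => S.comp t.fst t.snd)
    (fun d a b h (t : LaxProf.CompEl P P d a) => (S.reg_comp h t.fst t.snd).symm)
    (fun {d d'} g a t => by
      obtain rfl := ObjPair.eq_of_hom g
      rw [LaxProf.tr_self, LaxProf.tr_self])
    (fun a => by
      refine Eq.trans ?_ (S.id_comp (P.eps a))
      exact congrArg (fun t => S.comp (X := 1) (Y := 1) (Z := 1) t (P.eps a)) (S.id_one a).symm)
    (fun {d d' a b c} h (s : LaxProf.CompEl P P d a) (t : LaxProf.CompEl P P d' b) =>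
      (S.mul_comp h s.fst s.snd t.fst t.snd).symm)

/-- The monoid for `(∘, L)` of a sequential structure. -/
noncomputable abbrev SeqStructure.monObj {P : LaxProf E C} (S : SeqStructure P) : MonObj P where
  one := S.unitHom
  mul := S.mulHom
  one_mul := LaxProf.hom_ext fun d a (t : LaxProf.CompEl (LaxProf.unitLax E C) P d a) => by
    obtain ⟨⟨⟨X⟩⟩, ⟨Y⟩⟩ := d
    obtain ⟨Z, f, t⟩ := t
    obtain ⟨⟨rfl : Z = Y⟩⟩ : ULift.{u} (PLift (Z = Y)) := t
    refine Eq.trans ?_ (P.tr_self _ f).symm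
    refine Eq.trans ?_ (S.comp_id f)
    exact congrArg (S.comp f) (P.tr_self _ _)
  mul_one := LaxProf.hom_ext fun d a (t : LaxProf.CompEl P (LaxProf.unitLax E C) d a) => by
    obtain ⟨⟨⟨X⟩⟩, ⟨Y⟩⟩ := d
    obtain ⟨Z, t, f⟩ := t
    obtain ⟨⟨rfl : X = Z⟩⟩ : ULift.{u} (PLift (X = Z)) := t
    refine Eq.trans ?_ (P.tr_self _ f).symm
    refine Eq.trans ?_ (S.id_comp f)
    exact congrArg (fun t => S.comp t f) (P.tr_self _ _)
  mul_assoc := LaxProf.hom_ext fun d a (t : LaxProf.CompEl (LaxProf.compLax P P) P d a) => by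
    let s : LaxProf.CompEl P P (op ⟨t.mid⟩, d.2) a := t.snd
    exact (S.comp_assoc t.fst s.fst s.snd).symm

/-- Monoids for `(∘, L)` are lax monoidal functors with a sequential structure. -/
noncomputable def monEquiv : Mon (LaxProf E C) ≃ Σ P : LaxProf E C, SeqStructure P where
  toFun M := ⟨M.X, SeqStructure.ofMonObj M.X⟩
  invFun x := { X := x.1, mon := x.2.monObj }
  left_inv M := by
    obtain ⟨P, m⟩ := M
    -- The unit of a monoid is determined by its multiplication.
    refine congrArg (fun m : MonObj P => ({ X := P, mon := m } : Mon (LaxProf E C)))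
      (MonObj.ext _ _ ?_)
    exact LaxProf.hom_ext fun _ _ _ => rfl
  right_inv x := by
    obtain ⟨P, S⟩ := x
    refine congrArg (Sigma.mk P) (SeqStructure.ext ?_ rfl)
    funext a X
    exact P.tr_self _ _

theorem data_monEquiv (M : Mon (LaxProf E C)) : (monEquiv M).2.data = monoidData M := rfl

/-! ### Enriched Freyd categories -/

/-- Freyd categories over a discrete monoidal category, enriched in copresheaves, are lax monoidal
functors with a sequential structure. -/
noncomputable def freydEquiv :
    FreydCategory (Copresheaf E) (Discrete C) ≃ Σ P : LaxProf E C, SeqStructure P where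
  toFun F := ⟨F.hom,
    { id := fun a X => app (F.ident ⟨X⟩) a (pt a)
      comp := fun {a X Y Z} f g => app (F.comp ⟨X⟩ ⟨Y⟩ ⟨Z⟩) a (prodMk f g)
      reg_id := fun h X => (app_reg _ h _).symm
      reg_comp := fun h X Y Z f g => (app_reg _ h _).symm
      id_comp := fun {a X Y} f => congrArg (fun t => app t a (prodMk (pt a) f)) (F.id_comp ⟨X⟩ ⟨Y⟩)
      comp_id := fun {a X Y} f => congrArg (fun t => app t a (prodMk f (pt a))) (F.comp_id ⟨X⟩ ⟨Y⟩)
      comp_assoc := fun {a X Y Z W} f g k =>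
        congrArg (fun t => app t a (prodMk (prodMk f g) k)) (F.assoc ⟨X⟩ ⟨Y⟩ ⟨Z⟩ ⟨W⟩)
      id_one := fun a => (congrArg (fun t => app t a (tstar a)) F.unit_eq).symm
      mul_id := fun {a b c} h X Y =>
        congrArg (fun t => app t c (tpair h (pt a) (pt b))) (F.ident_par ⟨X⟩ ⟨Y⟩)
      mul_comp := fun {a b c} h {X Y Z X' Y' Z'} f g k l =>
        congrArg (fun t => app t c (tpair h (prodMk f g) (prodMk k l)))
          (F.comp_par ⟨X⟩ ⟨Y⟩ ⟨Z⟩ ⟨X'⟩ ⟨Y'⟩ ⟨Z'⟩) }⟩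
  invFun x :=
    { hom := x.1
      ident := fun X => homMk (fun a _ => x.2.id a X.as) (fun h _ => (x.2.reg_id h _).symm)
      comp := fun X Y Z => homMk (fun a t => x.2.comp (fst t) (snd t))
        (fun h t => (x.2.reg_comp h _ _).symm)
      ident_natural := fun {X Y} f => by
        obtain rfl : X = Y := Discrete.ext (Discrete.eq_of_hom f)
        obtain rfl : f = 𝟙 X := Subsingleton.elim _ _
        rfl
      comp_natural_left := fun {X X'} f Y Z => by
        obtain rfl : X' = X := Discrete.ext (Discrete.eq_of_hom f)
        exact Copresheaf.hom_ext fun a t => (x.1.tr_self _ _).trans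
          (congrArg (fun s => x.2.comp s (snd t)) (x.1.tr_self _ _).symm)
      comp_natural_right := fun X Y Z Z' f => by
        obtain rfl : Z = Z' := Discrete.ext (Discrete.eq_of_hom f)
        exact Copresheaf.hom_ext fun a t => (x.1.tr_self _ _).trans
          (congrArg (fun s => x.2.comp (fst t) s) (x.1.tr_self _ _).symm)
      comp_natural_middle := fun X Y Y' f Z => by
        obtain rfl : Y = Y' := Discrete.ext (Discrete.eq_of_hom f)
        obtain rfl : f = 𝟙 Y := Subsingleton.elim _ _
        exact Copresheaf.hom_ext fun a t =>
          (congrArg (fun s => x.2.comp s (snd t)) (x.1.tr_self _ _)).trans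
          (congrArg (fun s => x.2.comp (fst t) s) (x.1.tr_self _ _).symm)
      id_comp := fun X Y => Copresheaf.hom_ext fun a t => x.2.id_comp _
      comp_id := fun X Y => Copresheaf.hom_ext fun a t => x.2.comp_id _
      assoc := fun W X Y Z => Copresheaf.hom_ext fun a t => x.2.comp_assoc _ _ _
      unit_eq := Copresheaf.hom_ext fun a t => (x.2.id_one a).symm
      ident_par := fun X Y => tensor_hom_ext fun a b c h _ _ => x.2.mul_id h _ _
      comp_par := fun X Y Z X' Y' Z' => tensor_hom_ext fun a b c h s t =>
        x.2.mul_comp h _ _ _ _ }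
  left_inv F := rfl
  right_inv x := rfl

theorem data_freydEquiv (F : FreydCategory (Copresheaf E) (Discrete C)) :
    (freydEquiv F).2.data = freydData F := rfl

/-! ### Graded monoidal categories: products regraded along `a ⊕ b ≤ c` -/

namespace GradedMonoidalCategory

/-- Change of endpoints along equalities of objects. -/
def cast (𝒞 : GradedMonoidalCategory E C) {a : E} {X Y X' Y' : C} (h : X = X') (k : Y = Y')
    (f : 𝒞.Hom a X Y) : 𝒞.Hom a X' Y' := h ▸ k ▸ f

variable (𝒞 : GradedMonoidalCategory E C)

theorem cast_heq {a : E} {X Y X' Y' : C} (h : X = X') (k : Y = Y') (f : 𝒞.Hom a X Y) :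
    HEq (𝒞.cast h k f) f := by
  subst h k; rfl

/-- The product at grades `a ⊕ b ≤ c`: the product of grade `a ⊕ b`, regraded to `c`. -/
noncomputable def tensLE {a b c : E} (h : AddLE a b c) {X Y X' Y' : C} (f : 𝒞.Hom a X Y)
    (g : 𝒞.Hom b X' Y') : 𝒞.Hom c (X * X') (Y * Y') :=
  𝒞.reg h.choose_spec.2 (𝒞.tens h.choose_spec.1 f g)

theorem tensLE_eq {a b c s : E} (h : AddLE a b c) (hs : s ∈ add a b) (hsc : s ≤ c) {X Y X' Y' : C}
    (f : 𝒞.Hom a X Y) (g : 𝒞.Hom b X' Y') : 𝒞.tensLE h f g = 𝒞.reg hsc (𝒞.tens hs f g) := by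
  obtain rfl := Part.mem_unique hs h.choose_spec.1
  rfl

theorem tensLE_of_mem {a b c : E} (h : c ∈ add a b) {X Y X' Y' : C}
    (f : 𝒞.Hom a X Y) (g : 𝒞.Hom b X' Y') : 𝒞.tensLE (addLE_of_mem h) f g = 𝒞.tens h f g := by
  rw [𝒞.tensLE_eq _ h le_rfl, 𝒞.reg_self]

theorem reg_tensLE {a b c c' : E} (h : AddLE a b c) (hc : c ≤ c') {X Y X' Y' : C}
    (f : 𝒞.Hom a X Y) (g : 𝒞.Hom b X' Y') :
    𝒞.reg hc (𝒞.tensLE h f g) = 𝒞.tensLE (h.mono le_rfl le_rfl hc) f g := by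
  obtain ⟨s, hs, hsc⟩ := id h
  rw [𝒞.tensLE_eq _ hs hsc, 𝒞.tensLE_eq _ hs (hsc.trans hc), 𝒞.reg_reg]

theorem tensLE_reg {a b a' b' c : E} (ha : a ≤ a') (hb : b ≤ b') (h : AddLE a' b' c)
    {X Y X' Y' : C} (f : 𝒞.Hom a X Y) (g : 𝒞.Hom b X' Y') :
    𝒞.tensLE h (𝒞.reg ha f) (𝒞.reg hb g) = 𝒞.tensLE (h.mono ha hb le_rfl) f g := by
  obtain ⟨s, hs, hsc⟩ := id h
  obtain ⟨t, ht, htc⟩ := AddLE.mono ⟨s, hs, le_rfl⟩ ha hb le_rfl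
  rw [𝒞.tensLE_eq _ hs hsc, 𝒞.tensLE_eq _ ht (htc.trans hsc), ← 𝒞.reg_reg htc hsc,
    𝒞.reg_tens ht hs ha hb htc]

theorem reg_heq {a b : E} (h : a ≤ b) {X Y X' Y' : C} (hX : X = X') (hY : Y = Y')
    {f : 𝒞.Hom a X Y} {g : 𝒞.Hom a X' Y'} (hfg : HEq f g) : HEq (𝒞.reg h f) (𝒞.reg h g) := by
  subst hX hY
  rw [eq_of_heq hfg]

/-- Both sides are regradings of triple products at the grade `(a ⊕ b) ⊕ c = a ⊕ (b ⊕ c)`. -/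
theorem tensLE_assoc {a b c x y z : E} (h1 : AddLE a b x) (h2 : AddLE x c z) (h3 : AddLE b c y)
    (h4 : AddLE a y z) {X Y X' Y' X'' Y'' : C} (f : 𝒞.Hom a X Y) (g : 𝒞.Hom b X' Y')
    (k : 𝒞.Hom c X'' Y'') :
    HEq (𝒞.tensLE h2 (𝒞.tensLE h1 f g) k) (𝒞.tensLE h4 f (𝒞.tensLE h3 g k)) := by
  obtain ⟨s, hs, hsx⟩ := id h1
  obtain ⟨r, hr, hry⟩ := id h3
  obtain ⟨t, ht, htz⟩ := h2.mono hsx le_rfl le_rfl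
  obtain ⟨r', hr', hat⟩ := PartialCommMonoid.assoc_right hs ht
  obtain rfl := Part.mem_unique hr hr'
  have e1 : 𝒞.tensLE h2 (𝒞.tensLE h1 f g) k = 𝒞.reg htz (𝒞.tens ht (𝒞.tens hs f g) k) := by
    have := 𝒞.tensLE_reg hsx le_rfl h2 (𝒞.tens hs f g) k
    rw [𝒞.reg_self] at this
    rw [𝒞.tensLE_eq _ hs hsx, this, 𝒞.tensLE_eq _ ht htz]
  have e2 : 𝒞.tensLE h4 f (𝒞.tensLE h3 g k) = 𝒞.reg htz (𝒞.tens hat f (𝒞.tens hr g k)) := by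
    have := 𝒞.tensLE_reg le_rfl hry h4 f (𝒞.tens hr g k)
    rw [𝒞.reg_self] at this
    rw [𝒞.tensLE_eq _ hr hry, this, 𝒞.tensLE_eq _ hat htz]
  -- `(a ⊕ b) ⊕ c` and `a ⊕ (b ⊕ c)` are the same grade, so only the endpoints differ.
  rw [e1, e2]
  exact 𝒞.reg_heq _ (mul_assoc _ _ _) (mul_assoc _ _ _) (𝒞.tens_assoc hs ht hr hat f g k)

/-- Left unitality at an arbitrary grade: `id_1` of grade `a` is the regrading of `id_1` of grade
`0`. -/
theorem id_tensLE {a b c : E} (h : AddLE a b c) {X Y : C} (f : 𝒞.Hom b X Y) :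
    HEq (𝒞.tensLE h (𝒞.id a 1) f) (𝒞.reg h.right_le f) := by
  have := 𝒞.tensLE_reg (zero_le' a) le_rfl h (𝒞.id zero 1) f
  rw [𝒞.reg_self, 𝒞.reg_id] at this
  rw [this, 𝒞.tensLE_eq _ (zero_mem b) h.right_le]
  exact 𝒞.reg_heq _ (one_mul _) (one_mul _) (𝒞.unit_tens f)

theorem tensLE_id {a b c : E} (h : AddLE a b c) {X Y : C} (f : 𝒞.Hom a X Y) :
    HEq (𝒞.tensLE h f (𝒞.id b 1)) (𝒞.reg h.left_le f) := by
  have := 𝒞.tensLE_reg le_rfl (zero_le' b) h f (𝒞.id zero 1)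
  rw [𝒞.reg_self, 𝒞.reg_id] at this
  rw [this, 𝒞.tensLE_eq _ (mem_zero a) h.left_le]
  exact 𝒞.reg_heq _ (mul_one _) (mul_one _) (𝒞.tens_unit f)

theorem id_tensLE_id {a b c : E} (h : AddLE a b c) (X Y : C) :
    𝒞.tensLE h (𝒞.id a X) (𝒞.id b Y) = 𝒞.id c (X * Y) := by
  have := 𝒞.tensLE_reg (zero_le' a) (zero_le' b) h (𝒞.id zero X) (𝒞.id zero Y)
  rw [𝒞.reg_id, 𝒞.reg_id] at this
  rw [this, 𝒞.tensLE_eq _ (mem_zero zero) (zero_le' c), 𝒞.id_tens, 𝒞.reg_id]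

theorem tensLE_comp {a b c : E} (h : AddLE a b c) {X Y Z X' Y' Z' : C} (f : 𝒞.Hom a X Y)
    (g : 𝒞.Hom a Y Z) (k : 𝒞.Hom b X' Y') (l : 𝒞.Hom b Y' Z') :
    𝒞.tensLE h (𝒞.comp f g) (𝒞.comp k l) = 𝒞.comp (𝒞.tensLE h f k) (𝒞.tensLE h g l) := by
  obtain ⟨s, hs, hsc⟩ := id h
  simp only [𝒞.tensLE_eq _ hs hsc, ← 𝒞.interchange, 𝒞.reg_comp]

/-! ### Graded monoidal categories: the lax monoidal functor of morphisms -/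

/-- The functor `(X, Y) ↦ ℂ_(-)(X; Y)`. -/
def homFunctor : ObjPair C ⥤ Copresheaf E where
  obj d := Copresheaf.mk (fun a => 𝒞.Hom a d.1.unop.as d.2.as) (fun h f => 𝒞.reg h f)
    (fun _ f => 𝒞.reg_self f) (fun h h' f => 𝒞.reg_reg h h' f)
  map {d d'} g := homMk
    (fun a (f : 𝒞.Hom a d.1.unop.as d.2.as) => (𝒞.cast (Discrete.eq_of_hom g.1.unop).symm
      (Discrete.eq_of_hom g.2) f : 𝒞.Hom a d'.1.unop.as d'.2.as))
    (fun h f => by obtain rfl := ObjPair.eq_of_hom g; rfl)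
  map_id d := Copresheaf.hom_ext fun _ _ => rfl
  map_comp {d d' d''} f g := by
    obtain rfl := ObjPair.eq_of_hom f
    obtain rfl := ObjPair.eq_of_hom g
    rfl

theorem app_map_heq {d d' : ObjPair C} (g : d ⟶ d') {a : E} (f : (𝒞.homFunctor.obj d).El a) :
    HEq (app (𝒞.homFunctor.map g) a f) f :=
  𝒞.cast_heq _ _ _

theorem app_map_self {d : ObjPair C} (g : d ⟶ d) {a : E} (f : (𝒞.homFunctor.obj d).El a) :
    app (𝒞.homFunctor.map g) a f = f := eq_of_heq (𝒞.app_map_heq g f)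

/-- The lax monoidal functor `(X, Y) ↦ ℂ_(-)(X; Y)`, with the products as laxator and the identities
of the unit object as lax unit. -/
noncomputable def homLax : LaxProf E C :=
  LaxProf.mkLax 𝒞.homFunctor
    (fun a => 𝒞.id a 1)
    (fun {d d' a b c} h f g => 𝒞.tensLE (X := d.1.unop.as) (Y := d.2.as) (X' := d'.1.unop.as)
      (Y' := d'.2.as) h f g)
    (fun h => (𝒞.reg_id h 1).symm)
    (fun hc h f g => (𝒞.reg_tensLE h hc f g).symm)
    (fun ha hb h f g => 𝒞.tensLE_reg ha hb h f g)
    (fun {d d' k k' a b c} h f g x y => by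
      obtain rfl := ObjPair.eq_of_hom f
      obtain rfl := ObjPair.eq_of_hom g
      rw [app_map_self, app_map_self]
      exact (𝒞.app_map_self (d := d ⊗ k) (f ⊗ₘ g) _).symm)
    (fun h1 h2 h3 h4 p q r => eq_of_heq ((𝒞.app_map_heq _ _).trans
      (𝒞.tensLE_assoc h1 h2 h3 h4 p q r)))
    (fun h p => eq_of_heq ((𝒞.app_map_heq _ _).trans (𝒞.id_tensLE h p)))
    (fun h p => eq_of_heq ((𝒞.app_map_heq _ _).trans (𝒞.tensLE_id h p)))

/-- The sequential structure given by the identities and compositions of the categories `ℂ_a`. -/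
noncomputable def seqStructure : SeqStructure 𝒞.homLax where
  id := 𝒞.id
  comp f g := 𝒞.comp f g
  reg_id h X := 𝒞.reg_id h X
  reg_comp h _ _ _ f g := 𝒞.reg_comp h f g
  id_comp f := 𝒞.id_comp f
  comp_id f := 𝒞.comp_id f
  comp_assoc f g k := 𝒞.comp_assoc f g k
  id_one _ := rfl
  mul_id h X Y := 𝒞.id_tensLE_id h X Y
  mul_comp h _ _ _ _ _ _ f g k l := 𝒞.tensLE_comp h f g k l

theorem data_seqStructure : 𝒞.seqStructure.data = 𝒞.toGradedData := by
  have : @GradedData.tens _ _ _ _ 𝒞.seqStructure.data = @GradedData.tens _ _ _ _ 𝒞.toGradedData := by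
    funext a b c h X Y X' Y' f g
    exact 𝒞.tensLE_of_mem h f g
  exact congrArg (GradedData.mk 𝒞.Hom 𝒞.id 𝒞.comp 𝒞.reg) this

theorem ext_data {𝒞 𝒟 : GradedMonoidalCategory E C} (h : 𝒞.toGradedData = 𝒟.toGradedData) :
    𝒞 = 𝒟 := by
  cases 𝒞; cases 𝒟; cases h; rfl

end GradedMonoidalCategory

/-! ### Graded monoidal categories as lax monoidal functors with sequential structure -/

/-- Lax monoidal functors with the same object map are equal if the identities of their values form a
monoidal transformation between them. -/
theorem laxMonoidalFunctor_eq_of_hom {A : Type v} [Category.{w} A] [MonoidalCategory A]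
    {B : Type v'} [Category.{w'} B] [MonoidalCategory B] {P Q : LaxMonoidalFunctor A B} (α : P ⟶ Q)
    (hobj : P.obj = Q.obj) (hα : ∀ d, α.hom.app d = eqToHom (congrFun hobj d)) : P = Q := by
  obtain ⟨⟨obj, map, map_id, map_comp⟩, lax⟩ := P
  obtain ⟨⟨obj', map', map_id', map_comp'⟩, lax'⟩ := Q
  obtain rfl : obj = obj' := hobj
  have hα' : ∀ d, α.hom.app d = 𝟙 (obj d) := hα
  obtain rfl : @map = @map' := by
    funext d d' f
    have := α.hom.naturality f
    rw [hα', hα'] at this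
    exact (Category.comp_id _).symm.trans (this.trans (Category.id_comp _))
  refine congrArg _ (Functor.LaxMonoidal.ext ?_ ?_)
  · have := α.isMonoidal.unit
    rw [hα'] at this
    exact (Category.comp_id _).symm.trans this
  · funext d d'
    have := α.isMonoidal.tensor d d'
    rw [hα', hα', hα'] at this
    refine (Category.comp_id _).symm.trans (this.trans ?_)
    exact (congrArg (· ≫ _) (id_tensorHom_id _ _)).trans (Category.id_comp _)

/-- A monoidal transformation with identity components that preserves the sequential structures
forces them to be equal, together with the functors that carry them. -/
theorem SeqStructure.sigma_ext {P Q : LaxProf E C} (S : SeqStructure P) (T : SeqStructure Q)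
    (α : P ⟶ Q) (hobj : P.obj = Q.obj) (hα : ∀ d, α.hom.app d = eqToHom (congrFun hobj d))
    (hid : ∀ a X, LaxProf.ap α _ a (S.id a X) = T.id a X)
    (hcomp : ∀ {a X Y Z} (f : P.At (op ⟨X⟩, ⟨Y⟩) a) (g : P.At (op ⟨Y⟩, ⟨Z⟩) a),
      LaxProf.ap α _ a (S.comp f g) = T.comp (LaxProf.ap α _ a f) (LaxProf.ap α _ a g)) :
    (⟨P, S⟩ : Σ P : LaxProf E C, SeqStructure P) = ⟨Q, T⟩ := by
  obtain rfl := laxMonoidalFunctor_eq_of_hom α hobj hα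
  have hα' : α = 𝟙 P := LaxMonoidalFunctor.hom_ext (NatTrans.ext (funext hα))
  subst hα'
  exact congrArg (Sigma.mk P) (SeqStructure.ext (funext₂ hid) (by
    funext a X Y Z f g; exact hcomp f g))

/-- The identity on elements, from the lax monoidal functor rebuilt from the graded monoidal category
of `S` to the original one. It preserves laxators because a laxator at `a ⊕ b ≤ c` is the regrading
of the one at `a ⊕ b`. -/
noncomputable def SeqStructure.comparison {P : LaxProf E C} (S : SeqStructure P) :
    S.graded.homLax ⟶ P :=
  LaxProf.mkHom (P := S.graded.homLax) (fun d a x => x) (fun _ _ _ _ _ => rfl)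
    (fun {d d'} g a x => by
      obtain rfl := ObjPair.eq_of_hom g
      exact (S.graded.homLax.tr_self _ _).trans (P.tr_self _ _).symm)
    (fun a => S.id_one a)
    (fun h x y => P.reg_mul _ _ x y)

/-- Graded monoidal categories are lax monoidal functors with a sequential structure. -/
noncomputable def gradedEquiv :
    GradedMonoidalCategory E C ≃ Σ P : LaxProf E C, SeqStructure P where
  toFun 𝒞 := ⟨𝒞.homLax, 𝒞.seqStructure⟩
  invFun x := x.2.graded
  left_inv 𝒞 := GradedMonoidalCategory.ext_data 𝒞.data_seqStructure
  right_inv x := SeqStructure.sigma_ext _ x.2 x.2.comparison rfl (fun _ => rfl) (fun _ _ => rfl)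
    (fun _ _ => rfl)

end PCMGraded

theorem mainTheorem4 (E : Type u) [PCMGraded.PartialCommMonoid E] (C : Type u) [Monoid C] :
    (∃ Φ : PCMGraded.GradedMonoidalCategory E C ≃ Mon (PCMGraded.LaxProf E C),
      ∀ 𝒞, PCMGraded.monoidData (Φ 𝒞) = 𝒞.toGradedData) ∧
    (∃ Ψ : PCMGraded.GradedMonoidalCategory E C ≃
        PCMGraded.FreydCategory (PCMGraded.Copresheaf E) (Discrete C),
      ∀ 𝒞, PCMGraded.freydData (Ψ 𝒞) = 𝒞.toGradedData) := by
  refine ⟨⟨PCMGraded.gradedEquiv.trans PCMGraded.monEquiv.symm, fun 𝒞 => ?_⟩,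
    ⟨PCMGraded.gradedEquiv.trans PCMGraded.freydEquiv.symm, fun 𝒞 => ?_⟩⟩
  · rw [← PCMGraded.data_monEquiv, Equiv.trans_apply, Equiv.apply_symm_apply]
    exact 𝒞.data_seqStructure
  · rw [← PCMGraded.data_freydEquiv, Equiv.trans_apply, Equiv.apply_symm_apply]
    exact 𝒞.data_seqStructure
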